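/- Let $V:\mathbb{R}^3\to\mathbb{C}$ be a measurable function for which there exist numbers $a\in(0,1)$ and $b\in\mathbb{R}$ such that $$\int_{\mathbb{R}^3}|V||\psi|^2\le a\int_{\mathbb{R}^3}|\Delta\psi|^2+b\int_{\mathbb{R}^3}|\psi|^2\qquad\text{for all }\psi\in H^2(\mathbb{R}^3).$$ Let $H_V=\Delta^2\dot{+}V$ be the m-sectorial operator in $L^2(\mathbb{R}^3)$ associated with the closed sectorial form $$h_V(\varphi,\psi)=\int_{\mathbb{R}^3}\overline{\Delta\varphi}\,\Delta\psi+\int_{\mathbb{R}^3}\overline{\varphi}\,V\,\psi,\qquad \operatorname{Dom}(h_V)=H^2(\mathbb{R}^3),$$ that is, $\psi\in\operatorname{Dom}(H_V)$ and $H_V\psi=\eta$ if and only if $\psi\in H^2(\mathbb{R}^3)$, $\eta\in L^2(\mathbb{R}^3)$ and $h_V(\varphi,\psi)=\int_{\mathbb{R}^3}\overline{\varphi}\,\eta$ for all $\varphi\in H^2(\mathbb{R}^3)$. Then the point spectrum (the set of all eigenvalues, embedded ones included) of $H_V$ satisfies $$\sigma_{\mathrm p}(H_V)\subset\left\{\lambda\in\mathbb{C}:\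 |\lambda|\le\left(\sup_{\psi\in H^1(\mathbb{R}^3),\ \psi\ne0}\frac{\int_{\mathbb{R}^3}|V||\psi|^2}{\int_{\mathbb{R}^3}|\nabla\psi|^2}\right)^2\right\},$$ where the supremum is taken in $[0,+\infty]$ (so that the claim is void if it is infinite). -/

import Mathlib

open MeasureTheory
open scoped ENNReal SchwartzMap Laplacian LineDeriv ComplexConjugate

namespace Biharmonic

/-- The Euclidean space `ℝ³`. -/
abbrev E3 : Type := EuclideanSpace ℝ (Fin 3)

/-- The complex Hilbert space `L²(ℝ³)`. -/
abbrev L2 : Type := Lp ℂ 2 (volume : Measure E3)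

/-- The tempered distribution defined by an `L²` function. -/
noncomputable abbrev toDist : L2 →L[ℂ] 𝓢'(E3, ℂ) :=
  Lp.toTemperedDistributionCLM ℂ (volume : Measure E3) 2

theorem toDist_injective : Function.Injective toDist :=
  LinearMap.ker_eq_bot.mp
    (Lp.ker_toTemperedDistributionCLM_eq_bot (F := ℂ) (μ := (volume : Measure E3)) (p := 2))

/-- The Sobolev space `Hˢ(ℝ³)`, for `s ≥ 0`, as a subspace of `L²(ℝ³)`. -/
noncomputable def sobolev (s : ℝ) : Submodule ℂ L2 where
  carrier := {ψ | TemperedDistribution.MemSobolev s 2 (toDist ψ)}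
  add_mem' := by
    intro f g hf hg
    simpa only [Set.mem_ofPred_eq, map_add] using hf.add hg
  zero_mem' := by
    simp only [Set.mem_ofPred_eq, map_zero]
    exact TemperedDistribution.memSobolev_fun_zero E3 ℂ s 2
  smul_mem' := by
    intro c f hf
    simpa only [Set.mem_ofPred_eq, map_smul] using hf.smul c

theorem exists_lineDeriv (m : E3) (ψ : sobolev 1) :
    ∃ g : L2, toDist g = ∂_{m} (toDist (ψ : L2)) := by
  have h : TemperedDistribution.MemSobolev 1 2 (toDist (ψ : L2)) := ψ.2
  have h' := h.lineDerivOp (m := m)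
  rw [sub_self, TemperedDistribution.memSobolev_zero_iff] at h'
  obtain ⟨g, hg⟩ := h'
  exact ⟨g, hg.symm⟩

theorem exists_laplacian (ψ : sobolev 2) :
    ∃ g : L2, toDist g = Δ (toDist (ψ : L2)) := by
  have h : TemperedDistribution.MemSobolev 2 2 (toDist (ψ : L2)) := ψ.2
  have h' := h.laplacian
  rw [sub_self, TemperedDistribution.memSobolev_zero_iff] at h'
  obtain ⟨g, hg⟩ := h'
  exact ⟨g, hg.symm⟩

/-- The distributional derivative, in the direction `m`, of `ψ ∈ H¹(ℝ³)`,
as an element of `L²(ℝ³)`. -/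
noncomputable def weakDeriv (m : E3) (ψ : sobolev 1) : L2 :=
  (exists_lineDeriv m ψ).choose

theorem toDist_weakDeriv (m : E3) (ψ : sobolev 1) :
    toDist (weakDeriv m ψ) = ∂_{m} (toDist (ψ : L2)) :=
  (exists_lineDeriv m ψ).choose_spec

/-- The distributional Laplacian of `ψ ∈ H²(ℝ³)`, as an element of `L²(ℝ³)`. -/
noncomputable def weakLaplacian (ψ : sobolev 2) : L2 :=
  (exists_laplacian ψ).choose

theorem toDist_weakLaplacian (ψ : sobolev 2) :
    toDist (weakLaplacian ψ) = Δ (toDist (ψ : L2)) :=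
  (exists_laplacian ψ).choose_spec

theorem weakLaplacian_add (ψ χ : sobolev 2) :
    weakLaplacian (ψ + χ) = weakLaplacian ψ + weakLaplacian χ := by
  apply toDist_injective
  rw [map_add, toDist_weakLaplacian, toDist_weakLaplacian, toDist_weakLaplacian,
    Submodule.coe_add, map_add]
  exact map_add (LineDeriv.laplacianCLM ℝ E3 𝓢'(E3, ℂ)) _ _

theorem weakLaplacian_smul (c : ℂ) (ψ : sobolev 2) :
    weakLaplacian (c • ψ) = c • weakLaplacian ψ := by
  apply toDist_injective
  rw [map_smul, toDist_weakLaplacian, toDist_weakLaplacian, Submodule.coe_smul, map_smul]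
  simp only [← TemperedDistribution.laplacianCLM_apply, map_smul]

/-- The potential `V` is form-bounded relative to `Δ²` with relative bound less than one:
`∫ |V| |ψ|² ≤ a ∫ |Δψ|² + b ∫ |ψ|²` for all `ψ ∈ H²(ℝ³)`, with some `a ∈ (0, 1)` and `b ∈ ℝ`;
the finiteness of the left-hand side is part of the condition. -/
def RelFormBounded (V : E3 → ℂ) : Prop :=
  ∃ a ∈ Set.Ioo (0 : ℝ) 1, ∃ b : ℝ, ∀ ψ : sobolev 2,
    Integrable (fun x => ‖V x‖ * ‖(ψ : L2) x‖ ^ 2) ∧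
    (∫ x, ‖V x‖ * ‖(ψ : L2) x‖ ^ 2) ≤
      a * (∫ x, ‖weakLaplacian ψ x‖ ^ 2) + b * (∫ x, ‖(ψ : L2) x‖ ^ 2)

/-- The sesquilinear form `h_V(φ, ψ) = ∫ conj(Δφ) Δψ + ∫ conj(φ) V ψ` with domain `H²(ℝ³)`. -/
noncomputable def form (V : E3 → ℂ) (φ ψ : sobolev 2) : ℂ :=
  (∫ x, conj (weakLaplacian φ x) * weakLaplacian ψ x) +
    (∫ x, conj ((φ : L2) x) * V x * (ψ : L2) x)

theorem integral_conj_mul (f g : L2) : ∫ x, conj (f x) * g x = inner ℂ f g := by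
  rw [MeasureTheory.L2.inner_def]
  refine integral_congr_ae (Filter.Eventually.of_forall fun x => ?_)
  simp [mul_comm]

theorem integrable_potential {V : E3 → ℂ} (hVm : AEStronglyMeasurable V)
    (hV : RelFormBounded V) (φ ψ : sobolev 2) :
    Integrable (fun x => conj ((φ : L2) x) * V x * (ψ : L2) x) := by
  obtain ⟨a, -, b, h⟩ := hV
  refine Integrable.mono' ((h φ).1.add (h ψ).1) ?_ ?_
  · exact ((RCLike.continuous_conj.comp_aestronglyMeasurable
      (Lp.aestronglyMeasurable (φ : L2))).mul hVm).mul (Lp.aestronglyMeasurable (ψ : L2))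
  · refine Filter.Eventually.of_forall fun x => ?_
    simp only [norm_mul, RCLike.norm_conj, Pi.add_apply]
    have h0 := norm_nonneg (V x)
    have h1 : ‖(φ : L2) x‖ * ‖(ψ : L2) x‖ ≤ ‖(φ : L2) x‖ ^ 2 + ‖(ψ : L2) x‖ ^ 2 := by
      nlinarith [sq_nonneg (‖(φ : L2) x‖ - ‖(ψ : L2) x‖), sq_nonneg ‖(φ : L2) x‖,
        sq_nonneg ‖(ψ : L2) x‖]
    nlinarith [mul_le_mul_of_nonneg_left h1 h0]

theorem form_add {V : E3 → ℂ} (hVm : AEStronglyMeasurable V) (hV : RelFormBounded V)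
    (φ ψ χ : sobolev 2) : form V φ (ψ + χ) = form V φ ψ + form V φ χ := by
  have h : ∫ x, conj ((φ : L2) x) * V x * ((ψ + χ : sobolev 2) : L2) x =
      (∫ x, conj ((φ : L2) x) * V x * (ψ : L2) x) +
        ∫ x, conj ((φ : L2) x) * V x * (χ : L2) x := by
    rw [← integral_add (integrable_potential hVm hV φ ψ) (integrable_potential hVm hV φ χ)]
    refine integral_congr_ae ?_
    filter_upwards [Lp.coeFn_add (ψ : L2) (χ : L2)] with x hx
    rw [Submodule.coe_add, hx, Pi.add_apply, mul_add]
  simp only [form, integral_conj_mul, h, weakLaplacian_add, inner_add_right]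
  ring

theorem form_smul (V : E3 → ℂ) (c : ℂ) (φ ψ : sobolev 2) :
    form V φ (c • ψ) = c * form V φ ψ := by
  have h : ∫ x, conj ((φ : L2) x) * V x * ((c • ψ : sobolev 2) : L2) x =
      c * ∫ x, conj ((φ : L2) x) * V x * (ψ : L2) x := by
    rw [← integral_const_mul]
    refine integral_congr_ae ?_
    filter_upwards [Lp.coeFn_smul c (ψ : L2)] with x hx
    rw [Submodule.coe_smul, hx, Pi.smul_apply, smul_eq_mul]
    ring
  simp only [form, integral_conj_mul, h, weakLaplacian_smul, inner_smul_right]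
  ring

theorem dense_sobolev (s : ℝ) : Dense (sobolev s : Set L2) := by
  have h : DenseRange (SchwartzMap.toLpCLM ℂ ℂ 2 (volume : Measure E3)) :=
    SchwartzMap.denseRange_toLpCLM (by norm_num)
  refine h.mono ?_
  rintro _ ⟨f, rfl⟩
  change TemperedDistribution.MemSobolev s 2 (toDist _)
  have := SchwartzMap.memSobolev (s := s) (p := 2) f
  rw [← Lp.toTemperedDistribution_toLp_eq (p := 2)] at this
  exact this

theorem eq_of_inner_sobolev {η η' : L2}
    (h : ∀ φ : sobolev 2, inner ℂ (φ : L2) η = inner ℂ (φ : L2) η') : η = η' :=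
  (dense_sobolev 2).eq_of_inner_right (𝕜 := ℂ) (fun v hv => h ⟨v, hv⟩)

/-- `ψ` belongs to the domain of the operator associated with the form `h_V`, and the operator
maps it to `η`: one has `ψ ∈ H²(ℝ³)`, and `h_V(φ, ψ) = (φ, η)` for all `φ ∈ H²(ℝ³)`. -/
def Represents (V : E3 → ℂ) (ψ η : L2) : Prop :=
  ∃ h : ψ ∈ sobolev 2, ∀ φ : sobolev 2, form V φ ⟨ψ, h⟩ = inner ℂ (φ : L2) η

theorem Represents.unique {V : E3 → ℂ} {ψ η η' : L2} (h : Represents V ψ η)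
    (h' : Represents V ψ η') : η = η' := by
  obtain ⟨_, h⟩ := h
  obtain ⟨_, h'⟩ := h'
  exact eq_of_inner_sobolev fun φ => (h φ).symm.trans (h' φ)

theorem Represents.add {V : E3 → ℂ} (hVm : AEStronglyMeasurable V) (hV : RelFormBounded V)
    {ψ χ η ζ : L2} (h : Represents V ψ η) (h' : Represents V χ ζ) :
    Represents V (ψ + χ) (η + ζ) := by
  obtain ⟨hψ, h⟩ := h
  obtain ⟨hχ, h'⟩ := h'
  refine ⟨add_mem hψ hχ, fun φ => ?_⟩
  rw [inner_add_right, ← h φ, ← h' φ, ← form_add hVm hV]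
  rfl

theorem Represents.smul {V : E3 → ℂ} (c : ℂ) {ψ η : L2} (h : Represents V ψ η) :
    Represents V (c • ψ) (c • η) := by
  obtain ⟨hψ, h⟩ := h
  refine ⟨(sobolev 2).smul_mem c hψ, fun φ => ?_⟩
  rw [inner_smul_right, ← h φ, ← form_smul]
  rfl

/-- The m-sectorial operator `H_V = Δ² ∔ V` (form sum) in `L²(ℝ³)`, that is, the operator
associated with the closed sectorial form `h_V` by the representation theorem. -/
noncomputable def hamiltonian (V : E3 → ℂ) (hVm : AEStronglyMeasurable V)
    (hV : RelFormBounded V) : L2 →ₗ.[ℂ] L2 where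
  domain :=
    { carrier := {ψ | ∃ η, Represents V ψ η}
      add_mem' := by
        rintro ψ χ ⟨η, h⟩ ⟨ζ, h'⟩
        exact ⟨η + ζ, h.add hVm hV h'⟩
      zero_mem' := by
        refine ⟨0, (sobolev 2).zero_mem, fun φ => ?_⟩
        have h0 := form_smul V 0 φ 0
        rw [zero_mul, zero_smul] at h0
        rw [inner_zero_right]
        exact h0
      smul_mem' := by
        rintro c ψ ⟨η, h⟩
        exact ⟨c • η, h.smul c⟩ }
  toFun :=
    { toFun := fun ψ => ψ.2.choose
      map_add' := fun ψ χ =>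
        (ψ + χ).2.choose_spec.unique (ψ.2.choose_spec.add hVm hV χ.2.choose_spec)
      map_smul' := fun c ψ => (c • ψ).2.choose_spec.unique (ψ.2.choose_spec.smul c) }

/-- The point spectrum (the set of eigenvalues) of an operator in `L²(ℝ³)`. -/
def pointSpectrum (T : L2 →ₗ.[ℂ] L2) : Set ℂ :=
  {z | ∃ ψ : T.domain, (ψ : L2) ≠ 0 ∧ T ψ = z • (ψ : L2)}

/-- The supremum of `∫ |V| |ψ|² / ∫ |∇ψ|²` over all non-zero `ψ ∈ H¹(ℝ³)`,
with values in `[0, ∞]`. -/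
noncomputable def supQuotient (V : E3 → ℂ) : ℝ≥0∞ :=
  ⨆ (ψ : sobolev 1) (_ : ψ ≠ 0),
    (∫⁻ x, ‖V x‖ₑ * ‖(ψ : L2) x‖ₑ ^ 2) /
      ∫⁻ x, ∑ i : Fin 3, ‖weakDeriv (EuclideanSpace.single i 1) ψ x‖ₑ ^ 2

end Biharmonic

/-! Write `C` for `supQuotient V`, assumed finite, let `ψ` be an eigenfunction for `ev ≠ 0`, and put
`U = ∫ |V| |ψ|²`. The argument is of Birman-Schwinger type and shows `U ≤ |ev|^(-1/2) C U`; the form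
bound makes `U` finite, and `U = 0` would force `V ψ = 0` and then `ψ = 0`, so `U` can be cancelled.

The decisive fact is a pointwise comparison. For `k` in the open first quadrant the Green function
of `Δ² - k⁴` is `(2k²)⁻¹ (e^{ik|x|} - e^{-k|x|}) / (4π|x|)`. Both exponentials are at most
`e^{-δ|x|}` with `δ = min (Re k) (Im k)`, so the kernel is dominated by `|k|⁻²` times the Yukawa
kernel, with no loss of constant (`norm_biharmonicGreen_le`, `norm_resolvent_le`). This replaces a
fourth-order complex resolvent by a positive second-order one.

Let `w` be the Yukawa potential of `|φ|`, where `|φ| ≤ |V| |ψ|`. The energy identity gives `∫ |∇w|²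
≤ ∫ |φ| w`, hence `∫ |V| w² ≤ C ∫ |V| |ψ| w`, and Cauchy-Schwarz gives `∫ |V| |ψ| w ≤ C U`
(`lintegral_potential_mul_yukawa_le`). The bound does not depend on `δ`, so the spectral parameter
may approach the real axis; this is how embedded eigenvalues are covered. Testing the eigenvalue
equation with resolvents of `φ` at `z → conj ev` leaves only the potential term
(`exists_tendsto_resolvent_test`), so `|(φ, ψ)| ≤ |ev|^(-1/2) C U` (`norm_inner_le_of_density`).
Truncations of `|V| ψ`, used as `φ`, exhaust `U` (`lintegral_potential_le`). -/

namespace Biharmonic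

open FourierTransform Filter Topology

/-! ### Fourier description of `L²`, Sobolev membership and weak derivatives -/

/-- A locally integrable function is determined by its integrals against Schwartz
functions. -/
theorem ae_eq_of_schwartz {f g : E3 → ℂ} (hf : LocallyIntegrable f) (hg : LocallyIntegrable g)
    (h : ∀ u : 𝓢(E3, ℂ), ∫ x, u x * f x = ∫ x, u x * g x) : f =ᵐ[volume] g := by
  refine ae_eq_of_integral_contDiff_smul_eq hf hg fun u hu hc => ?_
  have hu' : ContDiff ℝ (⊤ : ℕ∞) (fun x => (u x : ℂ)) := Complex.ofRealCLM.contDiff.comp hu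
  have hc' : HasCompactSupport (fun x => (u x : ℂ)) := hc.comp_left (g := ((↑) : ℝ → ℂ)) (by simp)
  simpa using h (hc'.toSchwartzMap hu')

theorem locallyIntegrable_L2 (f : L2) : LocallyIntegrable (f : E3 → ℂ) :=
  (Lp.memLp f).locallyIntegrable (by norm_num)

theorem toDist_apply (f : L2) (u : 𝓢(E3, ℂ)) : toDist f u = ∫ x, u x * f x := by
  rw [Lp.toTemperedDistributionCLM_apply, Lp.toTemperedDistribution_apply]
  simp

theorem fourier_toDist (f : L2) : 𝓕 (toDist f) = toDist (𝓕 f) :=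
  Lp.fourier_toTemperedDistribution_eq f

/-- The Fourier transform of an integrable `L²` function is given by the integral. -/
theorem fourier_toLp_ae {f : E3 → ℂ} (h1 : Integrable f) (h2 : MemLp f 2) :
    (𝓕 (h2.toLp f) : L2) =ᵐ[volume] 𝓕 f := by
  have hcont : Continuous (𝓕 f) := VectorFourier.fourierIntegral_continuous
    Real.continuous_fourierChar continuous_inner h1
  refine ae_eq_of_schwartz (locallyIntegrable_L2 _) hcont.locallyIntegrable fun u => ?_
  rw [← toDist_apply, ← fourier_toDist, TemperedDistribution.fourier_apply, toDist_apply]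
  -- Fubini moves the transform between the two factors; the distributional transform is defined by
  -- the same transposition.
  have key : ∫ x, 𝓕 (u : E3 → ℂ) x * f x = ∫ x, u x * 𝓕 f x := by
    simpa using! VectorFourier.integral_fourierIntegral_smul_eq_flip (L := innerₗ E3)
      Real.continuous_fourierChar continuous_inner u.integrable h1
  rw [← key]
  refine integral_congr_ae ?_
  filter_upwards [h2.coeFn_toLp] with x hx
  rw [hx, SchwartzMap.fourier_coe]

theorem locallyIntegrable_mul_L2 {m : E3 → ℂ} (hm : Continuous m) (f : L2) :
    LocallyIntegrable (fun x => m x * f x) := by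
  have := (locallyIntegrable_L2 f).continuous_smul (𝕜 := ℂ)  hm
  simpa using this

theorem toDist_eq_smulLeft_iff {m : E3 → ℂ} (hm : m.HasTemperateGrowth) (f g : L2) :
    toDist g = TemperedDistribution.smulLeftCLM ℂ m (toDist f) ↔
      g =ᵐ[volume] fun x => m x * f x := by
  have key : ∀ u : 𝓢(E3, ℂ), TemperedDistribution.smulLeftCLM ℂ m (toDist f) u =
      ∫ x, u x * (m x * f x) := by
    intro u
    rw [TemperedDistribution.smulLeftCLM_apply_apply, toDist_apply]
    refine integral_congr_ae (Eventually.of_forall fun x => ?_)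
    simp only [SchwartzMap.smulLeftCLM_apply_apply hm, smul_eq_mul]
    ring
  constructor
  · intro h
    refine ae_eq_of_schwartz (locallyIntegrable_L2 g)
      (locallyIntegrable_mul_L2 hm.1.continuous f) fun u => ?_
    rw [← toDist_apply, h, key]
  · intro h
    ext u
    rw [key, toDist_apply]
    refine integral_congr_ae ?_
    filter_upwards [h] with x hx
    rw [hx]

/-- Every `L²` function is the Fourier transform of an `L²` function. -/
theorem exists_fourier_ae_eq {h : E3 → ℂ} (hh : MemLp h 2) : ∃ f : L2, (𝓕 f : L2) =ᵐ[volume] h :=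
  ⟨𝓕⁻ (hh.toLp h), by rw [FourierTransform.fourier_fourierInv_eq]; exact hh.coeFn_toLp⟩

theorem mem_sobolev_of_fourier {s : ℝ} {f : L2}
    (h : MemLp (fun ξ => (((1 + ‖ξ‖ ^ 2) ^ (s / 2) : ℝ) : ℂ) * (𝓕 f : L2) ξ) 2) :
    f ∈ sobolev s := by
  change TemperedDistribution.MemSobolev s 2 (toDist f)
  rw [TemperedDistribution.memSobolev_iff_exists_smulLeftCLM_fourier]
  refine ⟨h.toLp _, ?_⟩
  rw [fourier_toDist]
  exact ((toDist_eq_smulLeft_iff (by fun_prop) _ _).2 h.coeFn_toLp).symm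

theorem fourier_eq_of_toDist_eq {f g : L2} {m : E3 → ℂ} (hm : m.HasTemperateGrowth) (c : ℂ)
    (h : toDist g = c • TemperedDistribution.fourierMultiplierCLM ℂ m (toDist f)) :
    (𝓕 g : L2) =ᵐ[volume] fun ξ => c * m ξ * (𝓕 f : L2) ξ := by
  rw [TemperedDistribution.fourierMultiplierCLM_apply] at h
  apply_fun 𝓕 at h
  rw [FourierTransform.fourier_smul, FourierTransform.fourier_fourierInv_eq, fourier_toDist,
    fourier_toDist, ← smul_apply, ← TemperedDistribution.smulLeftCLM_smul hm,
    toDist_eq_smulLeft_iff (by fun_prop)] at h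
  simpa using h

theorem fourier_weakLaplacian (ψ : sobolev 2) :
    (𝓕 (weakLaplacian ψ) : L2) =ᵐ[volume]
      fun ξ => (-((2 * Real.pi * ‖ξ‖) ^ 2) : ℝ) * (𝓕 (ψ : L2) : L2) ξ := by
  have h := toDist_weakLaplacian ψ
  rw [TemperedDistribution.laplacian_eq_fourierMultiplierCLM] at h
  refine (fourier_eq_of_toDist_eq (f := (ψ : L2)) (c := ((-(2 * Real.pi) ^ 2 : ℝ) : ℂ))
    (m := fun ξ => ((‖ξ‖ ^ 2 : ℝ) : ℂ)) (by fun_prop) (h.trans ?_)).trans (Eventually.of_forall fun ξ => ?_)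
  · rfl
  · push_cast
    ring

theorem fourier_weakDeriv (m : E3) (ψ : sobolev 1) :
    (𝓕 (weakDeriv m ψ) : L2) =ᵐ[volume]
      fun ξ => (2 * Real.pi * Complex.I * (inner ℝ ξ m : ℝ)) * (𝓕 (ψ : L2) : L2) ξ := by
  have h := toDist_weakDeriv m ψ
  rw [TemperedDistribution.lineDeriv_eq_fourierMultiplierCLM] at h
  exact fourier_eq_of_toDist_eq (m := fun ξ => ((inner ℝ ξ m : ℝ) : ℂ)) (by fun_prop) _ h

/-! ### The Yukawa kernel and its Fourier transform -/

/-- The radial profile of the Yukawa kernel. -/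
noncomputable def yukawaProfile (κ : ℂ) (r : ℝ) : ℂ :=
  Complex.exp (-κ * r) / (4 * Real.pi * r)

/-- The Yukawa kernel `exp (-κ |x|) / (4 π |x|)`, the Green function of `-Δ + κ²` in `ℝ³`. -/
noncomputable def yukawa (κ : ℂ) (x : E3) : ℂ := yukawaProfile κ ‖x‖

theorem integrable_yukawa {κ : ℂ} (hκ : 0 < κ.re) : Integrable (yukawa κ) := by
  unfold yukawa
  rw [integrable_fun_norm_addHaar (volume : Measure E3)]
  have h := integrableOn_rpow_mul_exp_neg_mul_rpow (p := 1) (s := 1) (b := κ.re)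
    (by norm_num) (by norm_num) hκ
  refine Integrable.mono' (h.const_mul (4 * Real.pi)⁻¹) ?_ ?_
  · refine Measurable.aestronglyMeasurable ?_
    unfold yukawaProfile
    fun_prop
  · filter_upwards [ae_restrict_mem measurableSet_Ioi] with r hr
    have hr : 0 < r := hr
    have h4 : (0 : ℝ) < 4 * Real.pi * r := by positivity
    have hn : ‖(4 * Real.pi * r : ℂ)‖ = 4 * Real.pi * r := by
      rw [← abs_of_pos h4, ← Real.norm_eq_abs, ← Complex.norm_real]
      push_cast
      rfl
    simp only [yukawaProfile, finrank_euclideanSpace, Fintype.card_fin, norm_smul, norm_div, hn,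
      Complex.norm_exp, Real.rpow_one]
    simp only [Complex.mul_re, Complex.neg_re, Complex.ofReal_re, Complex.neg_im,
      Complex.ofReal_im, mul_zero, sub_zero, norm_pow, Real.norm_eq_abs, abs_of_pos hr]
    apply le_of_eq
    field_simp

/-- The integral of a function of the planar radius, shifted to height `t`. -/
theorem integral_yukawaProfile_plane {κ : ℂ} (hκ : 0 < κ.re) {t : ℝ} (ht : t ≠ 0) :
    ∫ w : EuclideanSpace ℝ (Fin 2), yukawaProfile κ √(t ^ 2 + ‖w‖ ^ 2) =
      Complex.exp (-κ * |t|) / (2 * κ) := by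
  have hκ0 : κ ≠ 0 := by
    rintro rfl
    simp at hκ
  rw [integral_fun_norm_addHaar (volume : Measure (EuclideanSpace ℝ (Fin 2)))
    (fun r => yukawaProfile κ √(t ^ 2 + r ^ 2))]
  have hpos : ∀ r : ℝ, 0 < t ^ 2 + r ^ 2 := fun r => by positivity
  -- In polar coordinates the area factor `r` is, up to `√(t² + r²)`, the derivative of `√(t² +
  -- r²)`, so the integrand has an elementary primitive.
  have hder : ∀ r ∈ Set.Ici (0 : ℝ), HasDerivAt
      (fun r : ℝ => -(4 * Real.pi * κ)⁻¹ * Complex.exp (-κ * (√(t ^ 2 + r ^ 2) : ℝ)))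
      (r ^ (2 - 1) • yukawaProfile κ √(t ^ 2 + r ^ 2)) r := by
    intro r _
    have h1 : HasDerivAt (fun r : ℝ => √(t ^ 2 + r ^ 2)) (r / √(t ^ 2 + r ^ 2)) r := by
      have := (((hasDerivAt_pow 2 r).const_add (t ^ 2))).sqrt (hpos r).ne'
      convert this using 1
      field_simp
      norm_num [mul_comm]
    have h2 := ((h1.ofReal_comp.const_mul (-κ)).cexp).const_mul (-(4 * Real.pi * κ)⁻¹)
    convert! h2 using 1
    have h3 : (√(t ^ 2 + r ^ 2) : ℂ) ≠ 0 := by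
      exact_mod_cast (Real.sqrt_pos.2 (hpos r)).ne'
    simp only [yukawaProfile, Complex.real_smul]
    push_cast
    field_simp
  have hint : IntegrableOn (fun r : ℝ => r ^ (2 - 1) • yukawaProfile κ √(t ^ 2 + r ^ 2))
      (Set.Ioi 0) := by
    refine Integrable.mono' ((exp_neg_integrableOn_Ioi 0 hκ).const_mul (4 * Real.pi)⁻¹) ?_ ?_
    · refine Measurable.aestronglyMeasurable ?_
      unfold yukawaProfile
      fun_prop
    · filter_upwards [ae_restrict_mem measurableSet_Ioi] with r hr
      have hr : 0 < r := hr
      have hs : r ≤ √(t ^ 2 + r ^ 2) := Real.le_sqrt_of_sq_le (by nlinarith [sq_nonneg t])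
      have hs0 : 0 < √(t ^ 2 + r ^ 2) := hr.trans_le hs
      set q := √(t ^ 2 + r ^ 2)
      have h4 : (0 : ℝ) < 4 * Real.pi * q := by positivity
      have hn : ‖(4 * Real.pi * q : ℂ)‖ = 4 * Real.pi * q := by
        rw [← abs_of_pos h4, ← Real.norm_eq_abs, ← Complex.norm_real]
        push_cast
        rfl
      simp only [yukawaProfile, norm_smul, norm_div, hn, Complex.norm_exp]
      simp only [Complex.mul_re, Complex.neg_re, Complex.ofReal_re, Complex.neg_im,
        Complex.ofReal_im, mul_zero, sub_zero, norm_pow, Real.norm_eq_abs, abs_of_pos hr]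
      have h5 : Real.exp (-κ.re * q) ≤ Real.exp (-κ.re * r) := by
        apply Real.exp_le_exp.2
        nlinarith
      calc r ^ (2 - 1) * (Real.exp (-κ.re * q) / (4 * Real.pi * q))
          = (4 * Real.pi)⁻¹ * ((r / q) * Real.exp (-κ.re * q)) := by
            field_simp
            norm_num
        _ ≤ (4 * Real.pi)⁻¹ * (1 * Real.exp (-κ.re * r)) := by
            gcongr
            exact (div_le_one hs0).2 hs
        _ = _ := by rw [one_mul]
  have hlim : Tendsto
      (fun r : ℝ => -(4 * Real.pi * κ)⁻¹ * Complex.exp (-κ * (√(t ^ 2 + r ^ 2) : ℝ))) atTop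
      (𝓝 0) := by
    rw [← mul_zero (-(4 * Real.pi * κ)⁻¹)]
    refine Tendsto.const_mul _ ?_
    rw [tendsto_zero_iff_norm_tendsto_zero]
    have h6 : Tendsto (fun r : ℝ => Real.exp (-(κ.re * r))) atTop (𝓝 0) :=
      Real.tendsto_exp_neg_atTop_nhds_zero.comp (tendsto_id.const_mul_atTop hκ)
    refine squeeze_zero' (Eventually.of_forall fun r => norm_nonneg _) ?_ h6
    filter_upwards [eventually_ge_atTop 0] with r hr
    have hs : r ≤ √(t ^ 2 + r ^ 2) := Real.le_sqrt_of_sq_le (by nlinarith [sq_nonneg t])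
    simp only [Complex.norm_exp, Complex.mul_re, Complex.neg_re, Complex.ofReal_re, Complex.neg_im,
        Complex.ofReal_im, mul_zero, sub_zero]
    apply Real.exp_le_exp.2
    nlinarith
  have hball : (volume : Measure (EuclideanSpace ℝ (Fin 2))).real (Metric.ball 0 1) = Real.pi := by
    simp [Measure.real, Real.pi_pos.le]
  have hdim : Module.finrank ℝ (EuclideanSpace ℝ (Fin 2)) = 2 := by simp
  rw [hdim, hball, integral_Ioi_of_hasDerivAt_of_tendsto' hder hint hlim]
  have hpi : (Real.pi : ℂ) ≠ 0 := by exact_mod_cast Real.pi_ne_zero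
  rw [zero_pow two_ne_zero, add_zero, Real.sqrt_sq_eq_abs, Complex.real_smul, nsmul_eq_mul]
  field_simp
  push_cast
  ring

/-- Once the plane orthogonal to the frequency is integrated out, this one-dimensional transform is
all that remains; each half-line carries a pure exponential. -/
theorem integral_exp_mul_exp_abs {κ : ℂ} (hκ : 0 < κ.re) (a : ℝ) :
    ∫ t : ℝ, Complex.exp ((-2 * Real.pi * (t * a) : ℝ) * Complex.I) *
      (Complex.exp (-κ * |t|) / (2 * κ)) = 1 / ((2 * Real.pi * a) ^ 2 + κ ^ 2) := by
  have hκ0 : κ ≠ 0 := by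
    rintro rfl
    simp at hκ
  set c : ℂ := 2 * Real.pi * a * Complex.I with hc
  have hcre : c.re = 0 := by simp [hc]
  have hp : 0 < (κ - c).re := by simp [hcre, hκ]
  have hm : (-κ - c).re < 0 := by simp [hcre, hκ]
  have hI1 : ∀ t ∈ Set.Iic (0 : ℝ), Complex.exp ((-2 * Real.pi * (t * a) : ℝ) * Complex.I) *
      (Complex.exp (-κ * |t|) / (2 * κ)) = (2 * κ)⁻¹ * Complex.exp ((κ - c) * t) := by
    intro t ht
    rw [abs_of_nonpos ht, mul_div_assoc', ← Complex.exp_add, div_eq_inv_mul]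
    congr 2
    rw [hc]
    push_cast
    ring
  have hI2 : ∀ t ∈ Set.Ioi (0 : ℝ), Complex.exp ((-2 * Real.pi * (t * a) : ℝ) * Complex.I) *
      (Complex.exp (-κ * |t|) / (2 * κ)) = (2 * κ)⁻¹ * Complex.exp ((-κ - c) * t) := by
    intro t ht
    rw [abs_of_pos ht, mul_div_assoc', ← Complex.exp_add, div_eq_inv_mul]
    congr 2
    rw [hc]
    push_cast
    ring
  rw [← intervalIntegral.integral_Iic_add_Ioi (b := 0), setIntegral_congr_fun measurableSet_Iic hI1,
    setIntegral_congr_fun measurableSet_Ioi hI2, integral_const_mul, integral_const_mul,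
    integral_exp_mul_complex_Iic hp, integral_exp_mul_complex_Ioi hm]
  · have h1 : κ - c ≠ 0 := by
      intro h
      simp [h] at hp
    have h2 : -κ - c ≠ 0 := by
      intro h
      simp [h] at hm
    have h3 : (2 * Real.pi * a : ℂ) ^ 2 + κ ^ 2 = -((κ - c) * (-κ - c)) := by
      rw [hc]
      ring_nf
      rw [Complex.I_sq]
      ring
    rw [h3]
    simp only [Complex.ofReal_zero, mul_zero, Complex.exp_zero]
    field_simp
    ring
  · exact (IntegrableOn.congr_fun ((integrableOn_exp_mul_complex_Iic hp 0).const_mul _)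
      (fun t ht => (hI1 t ht).symm) measurableSet_Iic)
  · exact (IntegrableOn.congr_fun ((integrableOn_exp_mul_complex_Ioi hm 0).const_mul _)
      (fun t ht => (hI2 t ht).symm) measurableSet_Ioi)

/-- There is a linear isometry of `ℝ × ℝ²` onto `ℝ³` that maps the first axis onto a given line. -/
theorem exists_isometry_map_axis (ξ : E3) :
    ∃ B : WithLp 2 (ℝ × EuclideanSpace ℝ (Fin 2)) ≃ₗᵢ[ℝ] E3, B (WithLp.toLp 2 (‖ξ‖, 0)) = ξ := by
  have hd : Module.finrank ℝ (WithLp 2 (ℝ × EuclideanSpace ℝ (Fin 2))) = 3 := by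
    rw [(WithLp.linearEquiv 2 ℝ (ℝ × EuclideanSpace ℝ (Fin 2))).finrank_eq]
    simp
  let B := ((stdOrthonormalBasis ℝ _).reindex (finCongr hd)).repr
  have hn : ‖B (WithLp.toLp 2 (‖ξ‖, 0))‖ = ‖ξ‖ := by
    rw [LinearIsometryEquiv.norm_map]
    simp
  -- The reflection in the bisecting hyperplane exchanges two vectors of equal length.
  exact ⟨B.trans (Submodule.reflection _), Submodule.reflection_sub hn⟩

/-- The Fourier transform of the Yukawa kernel. -/
theorem fourier_yukawa {κ : ℂ} (hκ : 0 < κ.re) (ξ : E3) :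
    𝓕 (yukawa κ) ξ = 1 / ((2 * Real.pi * ‖ξ‖) ^ 2 + κ ^ 2) := by
  obtain ⟨B, hB⟩ := exists_isometry_map_axis ξ
  set v : WithLp 2 (ℝ × EuclideanSpace ℝ (Fin 2)) := WithLp.toLp 2 (‖ξ‖, 0) with hv
  have hY : Integrable (yukawa κ ∘ B) :=
    (B.measurePreserving.integrable_comp_emb B.toHomeomorph.measurableEmbedding).2
      (integrable_yukawa hκ)
  have hF : Integrable (fun u => Complex.exp ((-2 * Real.pi * inner ℝ u v : ℝ) * Complex.I) •
      (yukawa κ ∘ B) u) := by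
    refine hY.bdd_mul (c := 1) ?_ ?_
    · exact Continuous.aestronglyMeasurable (by fun_prop)
    · exact Eventually.of_forall fun u => (Complex.norm_exp_ofReal_mul_I _).le
  have hmp := WithLp.volume_preserving_toLp (U := ℝ) (V := EuclideanSpace ℝ (Fin 2))
  have hemb : MeasurableEmbedding (WithLp.toLp 2 : ℝ × EuclideanSpace ℝ (Fin 2) → _) :=
    (MeasurableEquiv.toLp 2 (ℝ × EuclideanSpace ℝ (Fin 2))).measurableEmbedding
  have hF' := (hmp.integrable_comp_emb hemb).2 hF
  rw [← hB, ← Real.fourier_comp_linearIsometry, Real.fourier_eq', ← hmp.integral_comp hemb,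
    Measure.volume_eq_prod, LinearIsometryEquiv.norm_map]
  refine (integral_prod _ hF').trans ?_
  have hnv : ‖v‖ = ‖ξ‖ := by
    rw [hv]
    simp
  rw [hnv, ← integral_exp_mul_exp_abs hκ ‖ξ‖]
  refine integral_congr_ae ?_
  have h0 : ∀ᵐ t : ℝ, t ≠ 0 := by simp [ae_iff]
  filter_upwards [h0] with t ht
  rw [← integral_yukawaProfile_plane hκ ht, ← integral_const_mul]
  refine integral_congr_ae (Eventually.of_forall fun w => ?_)
  simp [hv, yukawa, WithLp.prod_norm_eq_of_L2, mul_comm]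

/-! ### Convolutions and the Green function of `Δ² - k⁴` -/

/-- The convolution of complex functions on `ℝ³`. -/
noncomputable abbrev conv (G φ : E3 → ℂ) : E3 → ℂ :=
  convolution G φ (ContinuousLinearMap.mul ℂ ℂ) volume

theorem integrable_conv {G φ : E3 → ℂ} (hG : Integrable G) (hφ : Integrable φ) :
    Integrable (conv G φ) :=
  hG.integrable_convolution _ hφ

theorem norm_conv_le {G φ : E3 → ℂ} {H χ : E3 → ℝ} (hH : Integrable H)
    (hχ : AEStronglyMeasurable χ) {M : ℝ} (hM : ∀ x, χ x ≤ M)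
    (hGH : ∀ x, ‖G x‖ ≤ H x) (hφχ : ∀ x, ‖φ x‖ ≤ χ x) (x : E3) :
    ‖conv G φ x‖ ≤ ∫ t, H t * χ (x - t) := by
  have hint : Integrable (fun t => H t * χ (x - t)) := by
    refine hH.mul_bdd (c := M) ?_ (Eventually.of_forall fun t => ?_)
    · exact hχ.comp_measurePreserving (Measure.measurePreserving_sub_left volume x)
    · rw [Real.norm_eq_abs, abs_of_nonneg ((norm_nonneg _).trans (hφχ _))]
      exact hM _
  rw [conv, convolution_def]
  refine norm_integral_le_of_norm_le hint (Eventually.of_forall fun t => ?_)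
  rw [ContinuousLinearMap.mul_apply', norm_mul]
  exact mul_le_mul (hGH t) (hφχ _) (norm_nonneg _) ((norm_nonneg _).trans (hGH t))

theorem memLp_two_of_bounded {f : E3 → ℂ} (h1 : Integrable f) {M : ℝ} (hM : ∀ x, ‖f x‖ ≤ M) :
    MemLp f 2 := by
  rw [memLp_two_iff_integrable_sq_norm h1.1]
  refine Integrable.mono' (h1.norm.const_mul M) (h1.1.norm.pow 2) (Eventually.of_forall fun x => ?_)
  rw [Real.norm_eq_abs, abs_of_nonneg (by positivity), pow_two]
  exact mul_le_mul_of_nonneg_right (hM x) (norm_nonneg _)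

theorem memLp_conv {G φ : E3 → ℂ} (hG : Integrable G) (hφ : Integrable φ) {M : ℝ}
    (hM : ∀ x, ‖φ x‖ ≤ M) : MemLp (conv G φ) 2 := by
  refine memLp_two_of_bounded (integrable_conv hG hφ) (M := ∫ t, ‖G t‖ * M) fun x => ?_
  exact norm_conv_le hG.norm (χ := fun _ => M) aestronglyMeasurable_const (M := M) (fun _ => le_rfl)
    (fun _ => le_rfl) hM x

theorem fourier_toLp_conv {G φ : E3 → ℂ} (hG : Integrable G) (hφ : Integrable φ) {M : ℝ}
    (hM : ∀ x, ‖φ x‖ ≤ M) :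
    (𝓕 ((memLp_conv hG hφ hM).toLp _) : L2) =ᵐ[volume]
      fun ξ => 𝓕 G ξ * (𝓕 ((memLp_two_of_bounded hφ hM).toLp φ) : L2) ξ := by
  filter_upwards [fourier_toLp_ae (integrable_conv hG hφ) (memLp_conv hG hφ hM),
    fourier_toLp_ae hφ (memLp_two_of_bounded hφ hM)] with ξ h1 h2
  rw [h1, h2, Real.fourier_mul_convolution_eq hG hφ]

/-- The Green function of `Δ² - k⁴`. -/
noncomputable def biharmonicGreen (k : ℂ) (x : E3) : ℂ :=
  (2 * k ^ 2)⁻¹ * (yukawa (-Complex.I * k) x - yukawa k x)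

/-- Both Yukawa kernels have rates `κ` with `Re κ ≥ δ`. The factor 2 from the triangle inequality
cancels the one in `(2k²)⁻¹`, which keeps the final constant at exactly 1. -/
theorem norm_biharmonicGreen_le {k : ℂ} {δ : ℝ} (hre : δ ≤ k.re) (him : δ ≤ k.im) (x : E3) :
    ‖biharmonicGreen k x‖ ≤ ‖k ^ 2‖⁻¹ * (Real.exp (-δ * ‖x‖) / (4 * Real.pi * ‖x‖)) := by
  have hx := norm_nonneg x
  have hn : ‖(4 * Real.pi * ‖x‖ : ℂ)‖ = 4 * Real.pi * ‖x‖ := by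
    rw [← abs_of_nonneg (show 0 ≤ 4 * Real.pi * ‖x‖ by positivity), ← Real.norm_eq_abs,
      ← Complex.norm_real]
    push_cast
    rfl
  have key : ∀ κ : ℂ, δ ≤ κ.re →
      ‖yukawa κ x‖ ≤ Real.exp (-δ * ‖x‖) / (4 * Real.pi * ‖x‖) := by
    intro κ hκ
    rw [yukawa, yukawaProfile, norm_div, hn, Complex.norm_exp]
    gcongr
    simp only [Complex.mul_re, Complex.neg_re, Complex.ofReal_re, Complex.neg_im,
      Complex.ofReal_im, mul_zero, sub_zero]
    nlinarith
  have h1 := key (-Complex.I * k) (by simpa using him)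
  have h2 := key k hre
  rw [biharmonicGreen, norm_mul, norm_inv, norm_mul, Complex.norm_ofNat]
  calc (2 * ‖k ^ 2‖)⁻¹ * ‖yukawa (-Complex.I * k) x - yukawa k x‖
      ≤ (2 * ‖k ^ 2‖)⁻¹ * (2 * (Real.exp (-δ * ‖x‖) / (4 * Real.pi * ‖x‖))) := by
        gcongr
        exact (norm_sub_le _ _).trans (by linarith)
    _ = _ := by
        rw [mul_inv]
        ring

theorem integrable_biharmonicGreen {k : ℂ} (hre : 0 < k.re) (him : 0 < k.im) :
    Integrable (biharmonicGreen k) :=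
  ((integrable_yukawa (κ := -Complex.I * k) (by simpa using him)).sub
    (integrable_yukawa hre)).const_mul _

theorem add_sq_ne_zero_of_re_pos {κ : ℂ} (hκ : 0 < κ.re) (a : ℝ) : (a : ℂ) ^ 2 + κ ^ 2 ≠ 0 := by
  intro h
  have h' : (κ - Complex.I * a) * (κ + Complex.I * a) = 0 := by
    rw [← h]
    ring_nf
    rw [Complex.I_sq]
    ring
  rcases mul_eq_zero.1 h' with h | h
  · have := congrArg Complex.re h
    simp at this
    exact hκ.ne' this
  · have := congrArg Complex.re h
    simp at this
    exact hκ.ne' this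

/-- Partial fractions: with `s = 2π|ξ|`, `(s⁴ - k⁴)⁻¹ = (2k²)⁻¹ ((s² - k²)⁻¹ - (s² + k²)⁻¹)`, and
`(-ik)² = -k²`. -/
theorem fourier_biharmonicGreen {k : ℂ} (hre : 0 < k.re) (him : 0 < k.im) (ξ : E3) :
    𝓕 (biharmonicGreen k) ξ = (((2 * Real.pi * ‖ξ‖ : ℝ) : ℂ) ^ 4 - k ^ 4)⁻¹ := by
  have him' : 0 < (-Complex.I * k).re := by simpa using him
  have hk : k ≠ 0 := by
    rintro rfl
    simp at hre
  have hI1 := integrable_yukawa him'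
  have hI2 := integrable_yukawa hre
  have hlin : 𝓕 (biharmonicGreen k) ξ =
      (2 * k ^ 2)⁻¹ * (𝓕 (yukawa (-Complex.I * k)) ξ - 𝓕 (yukawa k) ξ) := by
    simp only [Real.fourier_eq', biharmonicGreen]
    rw [← integral_sub, ← integral_const_mul]
    · congr 1
      ext x
      simp only [smul_eq_mul]
      ring
    · exact hI1.bdd_mul (c := 1) (Continuous.aestronglyMeasurable (by fun_prop))
        (Eventually.of_forall fun u => (Complex.norm_exp_ofReal_mul_I _).le)
    · exact hI2.bdd_mul (c := 1) (Continuous.aestronglyMeasurable (by fun_prop))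
        (Eventually.of_forall fun u => (Complex.norm_exp_ofReal_mul_I _).le)
  rw [hlin, fourier_yukawa him', fourier_yukawa hre]
  have h1 := add_sq_ne_zero_of_re_pos him' (2 * Real.pi * ‖ξ‖)
  have h2 := add_sq_ne_zero_of_re_pos hre (2 * Real.pi * ‖ξ‖)
  have h3 : ((2 * Real.pi * ‖ξ‖ : ℝ) : ℂ) = 2 * Real.pi * ‖ξ‖ := by push_cast; rfl
  rw [h3] at h1 h2 ⊢
  set a : ℂ := 2 * Real.pi * ‖ξ‖
  have h4 : (-Complex.I * k) ^ 2 = -k ^ 2 := by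
    rw [mul_pow, neg_sq, Complex.I_sq]
    ring
  rw [h4] at h1 ⊢
  have h5 : a ^ 4 - k ^ 4 = (a ^ 2 + -k ^ 2) * (a ^ 2 + k ^ 2) := by ring
  rw [h5]
  field_simp
  ring

theorem yukawa_ofReal (δ : ℝ) (x : E3) :
    yukawa δ x = ((Real.exp (-δ * ‖x‖) / (4 * Real.pi * ‖x‖) : ℝ) : ℂ) := by
  rw [yukawa, yukawaProfile]
  push_cast
  rfl

theorem conv_yukawa_ofReal (δ : ℝ) (χ : E3 → ℝ) (x : E3) :
    conv (yukawa δ) (fun y => (χ y : ℂ)) x =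
      ((∫ t, Real.exp (-δ * ‖t‖) / (4 * Real.pi * ‖t‖) * χ (x - t) : ℝ) : ℂ) := by
  rw [conv, convolution_def, ← integral_complex_ofReal]
  congr 1
  ext t
  rw [ContinuousLinearMap.mul_apply', yukawa_ofReal]
  push_cast
  rfl

theorem integrable_yukawa_real {δ : ℝ} (hδ : 0 < δ) :
    Integrable (fun t : E3 => Real.exp (-δ * ‖t‖) / (4 * Real.pi * ‖t‖)) := by
  have h := (integrable_yukawa (κ := (δ : ℂ)) (by simpa using hδ)).re
  refine h.congr (Eventually.of_forall fun t => ?_)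
  simp only [yukawa_ofReal]
  exact Complex.ofReal_re _

/-- The resolvent of the bilaplacian is dominated pointwise by that of the Laplacian. -/
theorem norm_resolvent_le {k : ℂ} {δ : ℝ} (hδ : 0 < δ) (hre : δ ≤ k.re) (him : δ ≤ k.im)
    {φ : E3 → ℂ} (hφ : Integrable φ) {M : ℝ} (hM : ∀ x, ‖φ x‖ ≤ M) {r : L2}
    (hr : (𝓕 r : L2) =ᵐ[volume] fun ξ => (((2 * Real.pi * ‖ξ‖ : ℝ) : ℂ) ^ 4 - k ^ 4)⁻¹ *
      (𝓕 ((memLp_two_of_bounded hφ hM).toLp φ) : L2) ξ) :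
    ∀ᵐ x, ‖r x‖ ≤ ‖k ^ 2‖⁻¹ * ‖conv (yukawa δ) (fun y => (‖φ y‖ : ℂ)) x‖ := by
  have hre' := hδ.trans_le hre
  have him' := hδ.trans_le him
  have hG := integrable_biharmonicGreen hre' him'
  have heq : (𝓕 r : L2) = 𝓕 ((memLp_conv hG hφ hM).toLp _) := by
    apply Lp.ext
    filter_upwards [hr, fourier_toLp_conv hG hφ hM] with ξ h1 h2
    rw [h1, h2, fourier_biharmonicGreen hre' him']
  have heq' : r = (memLp_conv hG hφ hM).toLp _ :=
    (Lp.fourierTransformₗᵢ E3 ℂ).injective heq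
  rw [heq']
  filter_upwards [(memLp_conv hG hφ hM).coeFn_toLp] with x hx
  rw [hx]
  refine (norm_conv_le ((integrable_yukawa_real hδ).const_mul _) hφ.1.norm hM
    (norm_biharmonicGreen_le hre him) (fun _ => le_rfl) x).trans (le_of_eq ?_)
  rw [conv_yukawa_ofReal, Complex.norm_real, Real.norm_eq_abs, abs_of_nonneg, ← integral_const_mul]
  · simp only [mul_assoc]
  · exact integral_nonneg fun t => by positivity

/-! ### Energy estimate for Yukawa potentials -/

theorem lintegral_enorm_sq (f : L2) : ∫⁻ x, ‖f x‖ₑ ^ 2 = ‖f‖ₑ ^ 2 := by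
  have := eLpNorm_nnreal_pow_eq_lintegral (μ := (volume : Measure E3)) (f := (f : E3 → ℂ))
    (p := 2) two_ne_zero
  rw [Lp.enorm_def]
  simpa using this.symm

theorem memLp_mul_of_bounded {m : E3 → ℂ} (hm : Measurable m) {K : ℝ} (hK : ∀ x, ‖m x‖ ≤ K)
    (f : L2) : MemLp (fun x => m x * f x) 2 :=
  (Lp.memLp f).mul (memLp_top_of_bound hm.aestronglyMeasurable K (Eventually.of_forall hK))

theorem inner_eq_integral_fourier (f g : L2) :
    inner ℂ f g = ∫ ξ, conj ((𝓕 f : L2) ξ) * (𝓕 g : L2) ξ := by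
  rw [integral_conj_mul, Lp.inner_fourier_eq]

theorem integrable_conj_mul (f g : L2) : Integrable (fun x => conj (f x) * g x) := by
  refine (L2.integrable_inner (𝕜 := ℂ) f g).congr (Eventually.of_forall fun x => ?_)
  simp [mul_comm]

/-- Plancherel for the gradient; it also shows that the Dirichlet integral is finite. -/
theorem sum_norm_weakDeriv_sq (W : sobolev 1) :
    Integrable (fun ξ => (2 * Real.pi * ‖ξ‖) ^ 2 * ‖(𝓕 (W : L2) : L2) ξ‖ ^ 2) ∧
    ∫⁻ x, ∑ i : Fin 3, ‖weakDeriv (EuclideanSpace.single i 1) W x‖ₑ ^ 2 =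
      ENNReal.ofReal (∫ ξ, (2 * Real.pi * ‖ξ‖) ^ 2 * ‖(𝓕 (W : L2) : L2) ξ‖ ^ 2) := by
  have hpt : ∀ᵐ ξ, ∑ i : Fin 3,
      ‖(𝓕 (weakDeriv (EuclideanSpace.single i 1) W) : L2) ξ‖ ^ 2 =
        (2 * Real.pi * ‖ξ‖) ^ 2 * ‖(𝓕 (W : L2) : L2) ξ‖ ^ 2 := by
    have h := ae_all_iff.2 fun i : Fin 3 => fourier_weakDeriv (EuclideanSpace.single i 1) W
    filter_upwards [h] with ξ hξ
    have hn : ‖ξ‖ ^ 2 = ∑ i : Fin 3, ξ i ^ 2 := by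
      rw [EuclideanSpace.norm_sq_eq]
      simp
    rw [mul_pow _ ‖ξ‖, hn, Finset.mul_sum, Finset.sum_mul]
    refine Finset.sum_congr rfl fun i _ => ?_
    rw [hξ i]
    simp [mul_pow, EuclideanSpace.inner_single_right, abs_of_pos Real.pi_pos]
  have hint : Integrable (fun ξ => ∑ i : Fin 3,
      ‖(𝓕 (weakDeriv (EuclideanSpace.single i 1) W) : L2) ξ‖ ^ 2) := by
    refine integrable_finsetSum _ fun i _ => ?_
    exact (memLp_two_iff_integrable_sq_norm (Lp.aestronglyMeasurable _)).1 (Lp.memLp _)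
  have hint' := hint.congr hpt
  refine ⟨hint', ?_⟩
  have hmeas : ∀ f : L2, AEMeasurable (fun x => ‖f x‖ₑ ^ 2) := fun f =>
    (Lp.aestronglyMeasurable f).enorm.pow_const 2
  rw [ofReal_integral_eq_lintegral_ofReal hint' (Eventually.of_forall fun ξ => by positivity),
    lintegral_finsetSum' _ fun i _ => hmeas _]
  simp_rw [lintegral_enorm_sq]
  have h2 : ∀ f : L2, ‖f‖ₑ = ‖(𝓕 f : L2)‖ₑ := fun f => by
    rw [← ofReal_norm, ← ofReal_norm, Lp.norm_fourier_eq]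
  simp_rw [h2 (weakDeriv _ W), ← lintegral_enorm_sq]
  rw [← lintegral_finsetSum' _ fun i _ => hmeas _]
  refine lintegral_congr_ae ?_
  filter_upwards [hpt] with ξ hξ
  rw [← hξ, ENNReal.ofReal_sum_of_nonneg fun i _ => by positivity]
  refine Finset.sum_congr rfl fun i _ => ?_
  rw [ENNReal.ofReal_pow (norm_nonneg _), ofReal_norm]

/-- If `-Δ w + δ² w = f` then `w ∈ H¹(ℝ³)` and `∫ |∇w|² ≤ Re (f, w)`. -/
theorem yukawa_energy {δ : ℝ} (hδ : 0 < δ) {f w : L2}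
    (hw : (𝓕 w : L2) =ᵐ[volume]
      fun ξ => (((2 * Real.pi * ‖ξ‖) ^ 2 + δ ^ 2 : ℝ) : ℂ)⁻¹ * (𝓕 f : L2) ξ) :
    ∃ W : sobolev 1, (W : L2) = w ∧
      ∫⁻ x, ∑ i : Fin 3, ‖weakDeriv (EuclideanSpace.single i 1) W x‖ₑ ^ 2 ≤
        ENNReal.ofReal (RCLike.re (inner ℂ f w)) := by
  have hmem : w ∈ sobolev 1 := by
    refine mem_sobolev_of_fourier (MemLp.ae_eq (f := fun ξ =>
      ((((1 + ‖ξ‖ ^ 2) ^ ((1 : ℝ) / 2) : ℝ) : ℂ) *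
        (((2 * Real.pi * ‖ξ‖) ^ 2 + δ ^ 2 : ℝ) : ℂ)⁻¹) * (𝓕 f : L2) ξ) ?_
      (memLp_mul_of_bounded (by fun_prop) (K := 1 + (δ ^ 2)⁻¹) (fun ξ => ?_) _))
    · filter_upwards [hw] with ξ hξ
      rw [hξ, mul_assoc]
    · have h1 : (1 + ‖ξ‖ ^ 2) ^ ((1 : ℝ) / 2) ≤ 1 + ‖ξ‖ ^ 2 := by
        conv_rhs => rw [← Real.rpow_one (1 + ‖ξ‖ ^ 2)]
        exact Real.rpow_le_rpow_of_exponent_le (by nlinarith [sq_nonneg ‖ξ‖]) (by norm_num)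
      rw [← Complex.ofReal_inv, ← Complex.ofReal_mul, Complex.norm_real, Real.norm_eq_abs,
        abs_of_nonneg (by positivity), ← div_eq_mul_inv, div_le_iff₀ (by positivity)]
      refine h1.trans ?_
      have hpi : 1 ≤ (2 * Real.pi) ^ 2 := by nlinarith [Real.pi_gt_three]
      have hd : (δ ^ 2)⁻¹ * δ ^ 2 = 1 := inv_mul_cancel₀ (by positivity)
      have hd' : 0 ≤ (δ ^ 2)⁻¹ := by positivity
      have hs : ‖ξ‖ ^ 2 ≤ (2 * Real.pi * ‖ξ‖) ^ 2 := by
        rw [mul_pow]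
        nlinarith [sq_nonneg ‖ξ‖]
      nlinarith [mul_nonneg hd' (sq_nonneg (2 * Real.pi * ‖ξ‖)), sq_nonneg δ]
  refine ⟨⟨w, hmem⟩, rfl, ?_⟩
  obtain ⟨hint, heq⟩ := sum_norm_weakDeriv_sq ⟨w, hmem⟩
  rw [heq]
  refine ENNReal.ofReal_le_ofReal ?_
  rw [inner_eq_integral_fourier, ← integral_re (integrable_conj_mul _ _)]
  refine integral_mono_ae hint (integrable_conj_mul _ _).re ?_
  filter_upwards [hw] with ξ hξ
  have hpos : 0 < (2 * Real.pi * ‖ξ‖) ^ 2 + δ ^ 2 := by positivity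
  have hf : (𝓕 f : L2) ξ = (((2 * Real.pi * ‖ξ‖) ^ 2 + δ ^ 2 : ℝ) : ℂ) * (𝓕 w : L2) ξ := by
    rw [hξ, mul_inv_cancel_left₀ (by exact_mod_cast hpos.ne')]
  simp only [hf, map_mul, Complex.conj_ofReal, mul_assoc]
  rw [← Complex.normSq_eq_conj_mul_self, ← Complex.ofReal_mul, Complex.normSq_eq_norm_sq]
  simp only [RCLike.re_to_complex, Complex.ofReal_re]
  -- The difference of the two sides is `δ² |ŵ|² ≥ 0`, which is discarded.
  nlinarith [mul_nonneg (sq_nonneg δ) (sq_nonneg ‖(𝓕 w : L2) ξ‖)]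

theorem lintegral_le_supQuotient (V : E3 → ℂ) (hC : supQuotient V ≠ ∞) (W : sobolev 1) :
    ∫⁻ x, ‖V x‖ₑ * ‖(W : L2) x‖ₑ ^ 2 ≤ supQuotient V *
      ∫⁻ x, ∑ i : Fin 3, ‖weakDeriv (EuclideanSpace.single i 1) W x‖ₑ ^ 2 := by
  by_cases hW : W = 0
  · subst hW
    have h0 : ∀ᵐ x, ‖V x‖ₑ * ‖((0 : sobolev 1) : L2) x‖ₑ ^ 2 = 0 := by
      filter_upwards [Lp.coeFn_zero ℂ 2 (volume : Measure E3)] with x hx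
      rw [Submodule.coe_zero, hx]
      simp
    rw [lintegral_congr_ae h0]
    simp
  · have h := le_iSup₂ (f := fun (ψ : sobolev 1) (_ : ψ ≠ 0) =>
      (∫⁻ x, ‖V x‖ₑ * ‖(ψ : L2) x‖ₑ ^ 2) /
        ∫⁻ x, ∑ i : Fin 3, ‖weakDeriv (EuclideanSpace.single i 1) ψ x‖ₑ ^ 2) W hW
    change _ ≤ supQuotient V at h
    have htop : ∫⁻ x, ∑ i : Fin 3, ‖weakDeriv (EuclideanSpace.single i 1) W x‖ₑ ^ 2 ≠ ∞ := by
      rw [(sum_norm_weakDeriv_sq W).2]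
      exact ENNReal.ofReal_ne_top
    -- A vanishing gradient integral needs no separate argument: a nonzero numerator would then make
    -- the quotient infinite, against `hC`.
    exact (ENNReal.div_le_iff_le_mul (Or.inr hC) (Or.inl htop)).1 h

/-- The energy estimate for the Yukawa potential of a nonnegative density. -/
theorem lintegral_potential_yukawa_le (V : E3 → ℂ) (hC : supQuotient V ≠ ∞) {δ : ℝ} (hδ : 0 < δ)
    {φ : E3 → ℂ} (hφ : Integrable φ) {M : ℝ} (hM : ∀ x, ‖φ x‖ ≤ M) :
    ∫⁻ x, ‖V x‖ₑ * ‖conv (yukawa δ) (fun y => (‖φ y‖ : ℂ)) x‖ₑ ^ 2 ≤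
        supQuotient V * ∫⁻ x, ‖φ x‖ₑ * ‖conv (yukawa δ) (fun y => (‖φ y‖ : ℂ)) x‖ₑ ∧
      ∫⁻ x, ‖φ x‖ₑ * ‖conv (yukawa δ) (fun y => (‖φ y‖ : ℂ)) x‖ₑ ≠ ∞ := by
  have hδ' : 0 < (δ : ℂ).re := by simpa using hδ
  have hY := integrable_yukawa hδ'
  have hχ : Integrable (fun y => (‖φ y‖ : ℂ)) := hφ.norm.ofReal
  have hχM : ∀ x, ‖(‖φ x‖ : ℂ)‖ ≤ M := fun x => by simpa using hM x
  set χ : E3 → ℂ := fun y => (‖φ y‖ : ℂ)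
  have hc := (memLp_conv hY hχ hχM).coeFn_toLp
  have hχc := (memLp_two_of_bounded hχ hχM).coeFn_toLp
  obtain ⟨W, hW, hle⟩ := yukawa_energy hδ (f := (memLp_two_of_bounded hχ hχM).toLp χ)
    (w := (memLp_conv hY hχ hχM).toLp _) (by
      filter_upwards [fourier_toLp_conv hY hχ hχM] with ξ hξ
      rw [hξ, fourier_yukawa hδ', one_div]
      push_cast
      rfl)
  have hE : ENNReal.ofReal (RCLike.re (inner ℂ ((memLp_two_of_bounded hχ hχM).toLp χ)
      ((memLp_conv hY hχ hχM).toLp _))) = ∫⁻ x, ‖φ x‖ₑ * ‖conv (yukawa δ) χ x‖ₑ := by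
    have hpt : ∀ᵐ x, RCLike.re (conj ((memLp_two_of_bounded hχ hχM).toLp χ x) *
        (memLp_conv hY hχ hχM).toLp _ x) = ‖φ x‖ * ‖conv (yukawa δ) χ x‖ := by
      filter_upwards [hc, hχc] with x h1 h2
      rw [h1, h2]
      simp only [χ]
      rw [conv_yukawa_ofReal, Complex.conj_ofReal, Complex.norm_real, Real.norm_eq_abs,
        abs_of_nonneg (integral_nonneg fun t => by positivity), ← Complex.ofReal_mul]
      rfl
    rw [← integral_conj_mul, ← integral_re (integrable_conj_mul _ _),
      ofReal_integral_eq_lintegral_ofReal (integrable_conj_mul _ _).re]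
    · refine lintegral_congr_ae ?_
      filter_upwards [hpt] with x hx
      rw [hx, ENNReal.ofReal_mul (norm_nonneg _), ofReal_norm, ofReal_norm]
    · filter_upwards [hpt] with x hx
      rw [hx]
      exact mul_nonneg (norm_nonneg _) (norm_nonneg _)
  rw [← hE]
  refine ⟨?_, ENNReal.ofReal_ne_top⟩
  calc ∫⁻ x, ‖V x‖ₑ * ‖conv (yukawa δ) χ x‖ₑ ^ 2
      = ∫⁻ x, ‖V x‖ₑ * ‖(W : L2) x‖ₑ ^ 2 := by
        refine lintegral_congr_ae ?_
        filter_upwards [hc] with x hx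
        rw [hW, hx]
    _ ≤ _ := lintegral_le_supQuotient V hC W
    _ ≤ _ := by gcongr

/-! ### The resolvent of the bilaplacian as a test function -/

theorem abs_im_le_norm_sub (z : ℂ) (a : ℝ) : |z.im| ≤ ‖(a : ℂ) ^ 4 - z‖ := by
  have h : ((a : ℂ) ^ 4 - z).im = -z.im := by
    rw [← Complex.ofReal_pow, Complex.sub_im, Complex.ofReal_im, zero_sub]
  rw [← abs_neg, ← h]
  exact Complex.abs_im_le_norm _

/-- The resolvent of the bilaplacian maps `L²(ℝ³)` into `H²(ℝ³)`. -/
theorem exists_resolvent {z : ℂ} (hz : z.im ≠ 0) (φ : L2) :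
    ∃ r : sobolev 2, ((𝓕 (r : L2) : L2) =ᵐ[volume]
      fun ξ => (((2 * Real.pi * ‖ξ‖ : ℝ) : ℂ) ^ 4 - z)⁻¹ * (𝓕 φ : L2) ξ) ∧
      ∀ ψ : sobolev 2, inner ℂ (weakLaplacian r) (weakLaplacian ψ) =
        inner ℂ φ (ψ : L2) + conj z * inner ℂ (r : L2) (ψ : L2) := by
  have him : 0 < |z.im| := abs_pos.2 hz
  have hd : ∀ ξ : E3, 0 < ‖((2 * Real.pi * ‖ξ‖ : ℝ) : ℂ) ^ 4 - z‖ := fun ξ =>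
    him.trans_le (abs_im_le_norm_sub z _)
  obtain ⟨r, hr⟩ := exists_fourier_ae_eq (memLp_mul_of_bounded
    (m := fun ξ : E3 => (((2 * Real.pi * ‖ξ‖ : ℝ) : ℂ) ^ 4 - z)⁻¹) (by fun_prop)
    (K := |z.im|⁻¹) (fun ξ => by
      rw [norm_inv]
      exact inv_anti₀ him (abs_im_le_norm_sub z _)) (𝓕 φ))
  have hmem : r ∈ sobolev 2 := by
    refine mem_sobolev_of_fourier (MemLp.ae_eq (f := fun ξ =>
      ((((1 + ‖ξ‖ ^ 2) ^ ((2 : ℝ) / 2) : ℝ) : ℂ) *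
        (((2 * Real.pi * ‖ξ‖ : ℝ) : ℂ) ^ 4 - z)⁻¹) * (𝓕 φ : L2) ξ) ?_
      -- With `s = 2π|ξ|` and `d = |s⁴ - z| ≥ |Im z|`, one has `1 + |ξ|² ≤ 2 + s⁴ ≤ 2 + |z| + d`,
      -- and `2 + |z| ≤ (2 + |z|) d / |Im z|`.
      (memLp_mul_of_bounded (by fun_prop) (K := (2 + ‖z‖) / |z.im| + 1) (fun ξ => ?_) _))
    · filter_upwards [hr] with ξ hξ
      rw [hξ, mul_assoc]
    · rw [norm_mul, norm_inv, Complex.norm_real, Real.norm_eq_abs, div_self two_ne_zero,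
        Real.rpow_one, abs_of_nonneg (by positivity), ← div_eq_mul_inv, div_le_iff₀ (hd ξ)]
      have h1 := abs_im_le_norm_sub z (2 * Real.pi * ‖ξ‖)
      have h2 : (2 * Real.pi * ‖ξ‖) ^ 4 ≤ ‖((2 * Real.pi * ‖ξ‖ : ℝ) : ℂ) ^ 4 - z‖ + ‖z‖ := by
        have := norm_add_le (((2 * Real.pi * ‖ξ‖ : ℝ) : ℂ) ^ 4 - z) z
        rwa [sub_add_cancel, norm_pow, Complex.norm_real, Real.norm_eq_abs,
          abs_of_nonneg (by positivity)] at this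
      have hpi : 1 ≤ (2 * Real.pi) ^ 2 := by nlinarith [Real.pi_gt_three]
      have hs : ‖ξ‖ ^ 2 ≤ (2 * Real.pi * ‖ξ‖) ^ 2 := by
        rw [mul_pow]
        nlinarith [sq_nonneg ‖ξ‖]
      set d := ‖((2 * Real.pi * ‖ξ‖ : ℝ) : ℂ) ^ 4 - z‖
      have h3 : 2 + ‖z‖ ≤ (2 + ‖z‖) / |z.im| * d := by
        rw [div_mul_eq_mul_div, le_div_iff₀ him]
        exact mul_le_mul_of_nonneg_left h1 (by positivity)
      nlinarith [sq_nonneg ((2 * Real.pi * ‖ξ‖) ^ 2 - 1)]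
  refine ⟨⟨r, hmem⟩, hr, fun ψ => ?_⟩
  simp only [inner_eq_integral_fourier]
  rw [← integral_const_mul, ← integral_add (integrable_conj_mul _ _)
    ((integrable_conj_mul _ _).const_mul _)]
  refine integral_congr_ae ?_
  filter_upwards [hr, fourier_weakLaplacian ψ, fourier_weakLaplacian ⟨r, hmem⟩] with ξ h1 h2 h3
  rw [h2, h3]
  have hφ : (𝓕 φ : L2) ξ = (((2 * Real.pi * ‖ξ‖ : ℝ) : ℂ) ^ 4 - z) * (𝓕 r : L2) ξ := by
    rw [h1, mul_inv_cancel_left₀ (norm_pos_iff.1 (hd ξ))]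
  rw [hφ]
  simp only [map_mul, map_sub, map_pow, Complex.conj_ofReal]
  push_cast
  ring

theorem exists_fourth_root {z : ℂ} (hz : z.im ≠ 0) : ∃ k : ℂ, k ^ 4 = z ∧ 0 < k.re ∧ 0 < k.im := by
  have hz0 : z ≠ 0 := by
    rintro rfl
    simp at hz
  -- Taking the logarithm of `-z` puts the cut on the positive axis: the argument of `z` lies in
  -- `(0, 2π)`, and a quarter of it in `(0, π/2)`.
  set w : ℂ := (Complex.log (-z) + Real.pi * Complex.I) / 4 with hw
  have him : w.im = (Complex.arg (-z) + Real.pi) / 4 := by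
    rw [hw]
    simp [Complex.log_im]
  have h1 : -Real.pi < Complex.arg (-z) := Complex.neg_pi_lt_arg _
  have h2 : Complex.arg (-z) < Real.pi := by
    refine lt_of_le_of_ne (Complex.arg_le_pi _) fun h => ?_
    rw [Complex.arg_eq_pi_iff] at h
    simp [hz] at h
  refine ⟨Complex.exp w, ?_, ?_, ?_⟩
  · rw [← Complex.exp_nat_mul, hw, Nat.cast_ofNat, mul_div_cancel₀ _ (by norm_num), Complex.exp_add,
      Complex.exp_log (neg_ne_zero.2 hz0), Complex.exp_pi_mul_I]
    ring
  · rw [Complex.exp_re, him]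
    refine mul_pos (Real.exp_pos _) (Real.cos_pos_of_mem_Ioo ⟨?_, ?_⟩) <;> linarith
  · rw [Complex.exp_im, him]
    refine mul_pos (Real.exp_pos _) (Real.sin_pos_of_pos_of_lt_pi ?_ ?_) <;> linarith

/-- The solution of `(Δ² - z) r = φ` as a test function in the eigenvalue equation. -/
theorem exists_resolvent_test {V : E3 → ℂ} {ev : ℂ} {ψ : sobolev 2}
    (hψ : ∀ φ : sobolev 2, form V φ ψ = ev * inner ℂ (φ : L2) (ψ : L2)) {z : ℂ} (hz : z.im ≠ 0)
    (φ : L2) :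
    ∃ r : sobolev 2, ((𝓕 (r : L2) : L2) =ᵐ[volume]
      fun ξ => (((2 * Real.pi * ‖ξ‖ : ℝ) : ℂ) ^ 4 - z)⁻¹ * (𝓕 φ : L2) ξ) ∧
      inner ℂ φ (ψ : L2) = (ev - conj z) * inner ℂ (r : L2) (ψ : L2) -
        ∫ x, conj ((r : L2) x) * V x * (ψ : L2) x := by
  obtain ⟨r, hr, h⟩ := exists_resolvent hz φ
  refine ⟨r, hr, ?_⟩
  have h1 := hψ r
  rw [form, integral_conj_mul, h] at h1
  linear_combination h1

/-- The exceptional frequencies lie on one sphere, a null set. This gives pointwise convergence even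
when `c` is in the essential spectrum of `Δ²`. -/
theorem ae_pow_four_ne (c : ℂ) : ∀ᵐ ξ : E3, ((2 * Real.pi * ‖ξ‖ : ℝ) : ℂ) ^ 4 ≠ c := by
  have h := Measure.addHaar_sphere (volume : Measure E3) 0 (√√‖c‖ / (2 * Real.pi))
  refine measure_mono_null (fun ξ hξ => ?_) h
  have hξ : ((2 * Real.pi * ‖ξ‖ : ℝ) : ℂ) ^ 4 = c := by simpa using hξ
  rw [mem_sphere_zero_iff_norm, ← hξ, norm_pow, Complex.norm_real, Real.norm_eq_abs,
    abs_of_nonneg (by positivity), show (2 * Real.pi * ‖ξ‖) ^ 4 = ((2 * Real.pi * ‖ξ‖) ^ 2) ^ 2 by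
      ring, Real.sqrt_sq (by positivity), Real.sqrt_sq (by positivity)]
  field_simp

/-- The part of the resolvent at `c + i τ` that is not absorbed by the eigenvalue equation vanishes
as `τ → 0`. -/
theorem tendsto_mul_inner_resolvent {c : ℂ} {τ : ℕ → ℝ} (hτ : Tendsto τ atTop (𝓝 0))
    (hτc : ∀ n, |τ n| ≤ |(c + τ n * Complex.I).im|) (φ ψ : L2) {r : ℕ → L2}
    (hr : ∀ n, (𝓕 (r n) : L2) =ᵐ[volume]
      fun ξ => (((2 * Real.pi * ‖ξ‖ : ℝ) : ℂ) ^ 4 - (c + τ n * Complex.I))⁻¹ * (𝓕 φ : L2) ξ) :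
    Tendsto (fun n => (τ n : ℂ) * inner ℂ (r n) ψ) atTop (𝓝 0) := by
  have h1 : ∀ n, (τ n : ℂ) * inner ℂ (r n) ψ =
      ∫ ξ, (τ n : ℂ) * (conj ((𝓕 (r n) : L2) ξ) * (𝓕 ψ : L2) ξ) := fun n => by
    rw [inner_eq_integral_fourier, integral_const_mul]
  simp_rw [h1]
  rw [← integral_zero E3 ℂ (μ := volume)]
  have hae := ae_all_iff.2 hr
  refine tendsto_integral_of_dominated_convergence
    (fun ξ => ‖conj ((𝓕 φ : L2) ξ) * (𝓕 ψ : L2) ξ‖) (fun n => ?_)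
    (integrable_conj_mul _ _).norm (fun n => ?_) ?_
  · exact ((integrable_conj_mul _ _).const_mul _).1
  · filter_upwards [hr n] with ξ hξ
    rw [hξ]
    simp only [norm_mul, RCLike.norm_conj, norm_inv, Complex.norm_real, Real.norm_eq_abs]
    -- Since `|τ| ≤ |Im z| ≤ |s⁴ - z|`, the prefactor `τ` absorbs the resolvent symbol and yields an
    -- integrable majorant independent of `n`.
    have h2 := (hτc n).trans (abs_im_le_norm_sub (c + τ n * Complex.I) (2 * Real.pi * ‖ξ‖))
    set d := ‖((2 * Real.pi * ‖ξ‖ : ℝ) : ℂ) ^ 4 - (c + τ n * Complex.I)‖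
    have h3 : |τ n| * d⁻¹ ≤ 1 := by
      rw [← div_eq_mul_inv]
      exact div_le_one_of_le₀ h2 (norm_nonneg _)
    calc |τ n| * (d⁻¹ * ‖(𝓕 φ : L2) ξ‖ * ‖(𝓕 ψ : L2) ξ‖)
        = (|τ n| * d⁻¹) * (‖(𝓕 φ : L2) ξ‖ * ‖(𝓕 ψ : L2) ξ‖) := by ring
      _ ≤ 1 * (‖(𝓕 φ : L2) ξ‖ * ‖(𝓕 ψ : L2) ξ‖) := by gcongr
      _ = _ := one_mul _
  · filter_upwards [hae, ae_pow_four_ne c] with ξ hξ hne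
    simp_rw [hξ]
    have hτ' : Tendsto (fun n => (τ n : ℂ)) atTop (𝓝 0) := 
      (Complex.continuous_ofReal.tendsto' 0 0 Complex.ofReal_zero).comp hτ
    have h2 : Tendsto (fun n => (((2 * Real.pi * ‖ξ‖ : ℝ) : ℂ) ^ 4 - (c + τ n * Complex.I))⁻¹)
        atTop (𝓝 (((2 * Real.pi * ‖ξ‖ : ℝ) : ℂ) ^ 4 - (c + 0 * Complex.I))⁻¹) := by
      refine ((hτ'.mul_const _).const_add c).const_sub _ |>.inv₀ ?_
      rw [zero_mul, add_zero]
      exact sub_ne_zero.2 hne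
    have h3 := hτ'.mul ((((Complex.continuous_conj.tendsto _).comp
      (h2.mul_const ((𝓕 φ : L2) ξ)))).mul_const ((𝓕 ψ : L2) ξ))
    rw [zero_mul] at h3
    exact h3

/-! ### The Birman-Schwinger bound -/

theorem lintegral_mul_sq_le {f g w : E3 → ℝ≥0∞} (hf : AEMeasurable f) (hg : AEMeasurable g)
    (hw : AEMeasurable w) :
    (∫⁻ x, f x * g x * w x) ^ 2 ≤ (∫⁻ x, f x * w x ^ 2) * ∫⁻ x, f x * g x ^ 2 := by
  have hsq : ∀ a b : ℝ≥0∞, (a ^ (2⁻¹ : ℝ) * b) ^ (2 : ℝ) = a * b ^ 2 := fun a b => by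
    rw [ENNReal.mul_rpow_of_nonneg _ _ zero_le_two, ← ENNReal.rpow_mul]
    norm_num
  have hroot : ∀ a : ℝ≥0∞, a ^ (2⁻¹ : ℝ) * a ^ (2⁻¹ : ℝ) = a := fun a => by
    rw [← ENNReal.rpow_add_of_nonneg _ _ (by norm_num) (by norm_num)]
    norm_num
  have h := ENNReal.lintegral_mul_le_Lp_mul_Lq volume Real.HolderConjugate.two_two
    (f := fun x => f x ^ (2⁻¹ : ℝ) * w x) (g := fun x => f x ^ (2⁻¹ : ℝ) * g x)
    ((hf.pow_const _).mul hw) ((hf.pow_const _).mul hg)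
  simp only [hsq, Pi.mul_apply, one_div] at h
  have h1 : ∀ x, f x ^ (2⁻¹ : ℝ) * w x * (f x ^ (2⁻¹ : ℝ) * g x) = f x * g x * w x := fun x => by
    rw [mul_mul_mul_comm, hroot]
    ring
  simp only [h1] at h
  calc (∫⁻ x, f x * g x * w x) ^ 2
      ≤ ((∫⁻ x, f x * w x ^ 2) ^ (2⁻¹ : ℝ) * (∫⁻ x, f x * g x ^ 2) ^ (2⁻¹ : ℝ)) ^ 2 := by gcongr
    _ = _ := by
      rw [sq, mul_mul_mul_comm, hroot, hroot]

/-- The Birman-Schwinger bound for a density dominated by `|V| |ψ|`. -/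
theorem lintegral_potential_mul_yukawa_le {V : E3 → ℂ} (hVm : AEStronglyMeasurable V)
    (hC : supQuotient V ≠ ∞) (ψ : L2) (hU : ∫⁻ x, ‖V x‖ₑ * ‖ψ x‖ₑ ^ 2 ≠ ∞) {δ : ℝ} (hδ : 0 < δ)
    {φ : E3 → ℂ} (hφ : Integrable φ) {M : ℝ} (hM : ∀ x, ‖φ x‖ ≤ M)
    (hφψ : ∀ᵐ x, ‖φ x‖ₑ ≤ ‖V x‖ₑ * ‖ψ x‖ₑ) :
    ∫⁻ x, ‖V x‖ₑ * ‖ψ x‖ₑ * ‖conv (yukawa δ) (fun y => (‖φ y‖ : ℂ)) x‖ₑ ≤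
      supQuotient V * ∫⁻ x, ‖V x‖ₑ * ‖ψ x‖ₑ ^ 2 := by
  obtain ⟨h1, h2⟩ := lintegral_potential_yukawa_le V hC hδ hφ hM
  set w := conv (yukawa δ) (fun y => (‖φ y‖ : ℂ))
  have hw : AEStronglyMeasurable w :=
    (integrable_conv (integrable_yukawa (by simpa using hδ)) hφ.norm.ofReal).1
  set P := ∫⁻ x, ‖V x‖ₑ * ‖ψ x‖ₑ * ‖w x‖ₑ
  set U := ∫⁻ x, ‖V x‖ₑ * ‖ψ x‖ₑ ^ 2
  set D := ∫⁻ x, ‖V x‖ₑ * ‖w x‖ₑ ^ 2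
  have hD : D ≠ ∞ := ne_top_of_le_ne_top (ENNReal.mul_ne_top hC h2) h1
  have hPD : P ^ 2 ≤ D * U :=
    lintegral_mul_sq_le hVm.enorm (Lp.aestronglyMeasurable ψ).enorm hw.enorm
  -- Finiteness comes before the estimate, because `P² ≤ C P U` is going to be divided by `P`.
  have hP : P ≠ ∞ := by
    intro h
    rw [h] at hPD
    exact (ENNReal.mul_ne_top hD hU) (top_le_iff.1 (by simpa using hPD))
  have hDP : D ≤ supQuotient V * P := by
    refine h1.trans ?_
    gcongr
    refine lintegral_mono_ae ?_
    filter_upwards [hφψ] with x hx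
    gcongr
  by_cases hP0 : P = 0
  · rw [hP0]
    exact zero_le
  · refine (ENNReal.mul_le_mul_iff_left hP0 hP).1 ?_
    calc P * P = P ^ 2 := (sq P).symm
      _ ≤ D * U := hPD
      _ ≤ supQuotient V * P * U := by gcongr
      _ = _ := by ring

/-! ### Passage to the eigenvalue along nonreal parameters -/

/-- Every complex number is a limit of non-real numbers, vertically and away from the real line. -/
theorem exists_vertical_approach (c : ℂ) : ∃ τ : ℕ → ℝ, Tendsto τ atTop (𝓝 0) ∧
    (∀ n, |τ n| ≤ |(c + τ n * Complex.I).im|) ∧ ∀ n, (c + τ n * Complex.I).im ≠ 0 := by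
  have h := tendsto_one_div_add_atTop_nhds_zero_nat (𝕜 := ℝ)
  have hp : ∀ n : ℕ, 0 < 1 / ((n : ℝ) + 1) := fun n => by positivity
  have him : ∀ t : ℝ, (c + t * Complex.I).im = c.im + t := fun t => by simp
  -- The sign of `τ` follows that of `Im c`, so that the imaginary parts add up instead of
  -- cancelling.
  rcases le_total 0 c.im with hc | hc
  · refine ⟨fun n => 1 / ((n : ℝ) + 1), h, fun n => ?_, fun n => ?_⟩
    · rw [him, abs_of_pos (hp n)]
      exact le_trans (by linarith) (le_abs_self _)
    · rw [him]
      linarith [hp n]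
  · refine ⟨fun n => -(1 / ((n : ℝ) + 1)), by simpa using h.neg, fun n => ?_, fun n => ?_⟩
    · rw [him, abs_neg, abs_of_pos (hp n)]
      exact le_trans (by linarith) (neg_le_abs _)
    · rw [him]
      linarith [hp n]

/-- The eigenvalue equation tested with the resolvents of an arbitrary `φ ∈ L²(ℝ³)` along a sequence
of spectral parameters tending to the conjugate of the eigenvalue. -/
theorem exists_tendsto_resolvent_test {V : E3 → ℂ} {ev : ℂ} {ψ : sobolev 2}
    (hψ : ∀ φ : sobolev 2, form V φ ψ = ev * inner ℂ (φ : L2) (ψ : L2)) (φ : L2) :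
    ∃ (z : ℕ → ℂ) (r : ℕ → sobolev 2), Tendsto z atTop (𝓝 (conj ev)) ∧ (∀ n, (z n).im ≠ 0) ∧
      (∀ n, (𝓕 (r n : L2) : L2) =ᵐ[volume]
        fun ξ => (((2 * Real.pi * ‖ξ‖ : ℝ) : ℂ) ^ 4 - z n)⁻¹ * (𝓕 φ : L2) ξ) ∧
      Tendsto (fun n => ∫ x, conj ((r n : L2) x) * V x * (ψ : L2) x) atTop
        (𝓝 (-inner ℂ φ (ψ : L2))) := by
  obtain ⟨τ, hτ, hτc, him⟩ := exists_vertical_approach (conj ev)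
  choose r hr htest using fun n => exists_resolvent_test hψ (him n) φ
  refine ⟨fun n => conj ev + τ n * Complex.I, r, ?_, him, hr, ?_⟩
  · have := ((Complex.continuous_ofReal.tendsto' 0 0 Complex.ofReal_zero).comp hτ).mul_const
      Complex.I |>.const_add (conj ev)
    rwa [zero_mul, add_zero] at this
  · have h := ((tendsto_mul_inner_resolvent hτ hτc φ (ψ : L2) hr).const_mul Complex.I).sub_const
      (inner ℂ φ (ψ : L2))
    rw [mul_zero, zero_sub] at h
    refine h.congr fun n => ?_
    rw [htest n]
    simp only [map_add, map_mul, Complex.conj_conj, Complex.conj_ofReal, Complex.conj_I]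
    ring

/-- With the potential term absent, testing with the resolvents of `ψ` itself leaves `(ψ, ψ) = 0` in
the limit: `Δ²` has no eigenvalues. -/
theorem eq_zero_of_potential_eq_zero {V : E3 → ℂ} {ev : ℂ} {ψ : sobolev 2}
    (hψ : ∀ φ : sobolev 2, form V φ ψ = ev * inner ℂ (φ : L2) (ψ : L2))
    (hV : ∀ᵐ x, V x * (ψ : L2) x = 0) : (ψ : L2) = 0 := by
  obtain ⟨z, r, -, -, -, h⟩ := exists_tendsto_resolvent_test hψ (ψ : L2)
  have h0 : ∀ n, ∫ x, conj ((r n : L2) x) * V x * (ψ : L2) x = 0 := fun n => by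
    refine integral_eq_zero_of_ae ?_
    filter_upwards [hV] with x hx
    rw [mul_assoc, hx, mul_zero]
    rfl
  simp_rw [h0] at h
  have := tendsto_nhds_unique h tendsto_const_nhds
  exact inner_self_eq_zero.1 (neg_eq_zero.1 this)

theorem norm_inner_le_of_density {V : E3 → ℂ} (hVm : AEStronglyMeasurable V)
    (hC : supQuotient V ≠ ∞) {ev : ℂ} (hev : ev ≠ 0) {ψ : sobolev 2}
    (hψ : ∀ φ : sobolev 2, form V φ ψ = ev * inner ℂ (φ : L2) (ψ : L2))
    (hU : ∫⁻ x, ‖V x‖ₑ * ‖(ψ : L2) x‖ₑ ^ 2 ≠ ∞)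
    {φ : E3 → ℂ} (hφ : Integrable φ) {M : ℝ} (hM : ∀ x, ‖φ x‖ ≤ M)
    (hφψ : ∀ᵐ x, ‖φ x‖ₑ ≤ ‖V x‖ₑ * ‖(ψ : L2) x‖ₑ) :
    ‖inner ℂ ((memLp_two_of_bounded hφ hM).toLp φ) (ψ : L2)‖ ≤
      (√‖ev‖)⁻¹ * (supQuotient V * ∫⁻ x, ‖V x‖ₑ * ‖(ψ : L2) x‖ₑ ^ 2).toReal := by
  obtain ⟨z, r, hz, him, hr, h⟩ := exists_tendsto_resolvent_test hψ
    ((memLp_two_of_bounded hφ hM).toLp φ)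
  have hB : supQuotient V * ∫⁻ x, ‖V x‖ₑ * ‖(ψ : L2) x‖ₑ ^ 2 ≠ ∞ := ENNReal.mul_ne_top hC hU
  have hz' : Tendsto (fun n => (√‖z n‖)⁻¹ *
      (supQuotient V * ∫⁻ x, ‖V x‖ₑ * ‖(ψ : L2) x‖ₑ ^ 2).toReal) atTop
      (𝓝 ((√‖ev‖)⁻¹ * (supQuotient V * ∫⁻ x, ‖V x‖ₑ * ‖(ψ : L2) x‖ₑ ^ 2).toReal)) := by
    have := hz.norm.sqrt
    rw [RCLike.norm_conj] at this
    exact (this.inv₀ (Real.sqrt_pos.2 (norm_pos_iff.2 hev)).ne').mul_const _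
  rw [← norm_neg]
  refine le_of_tendsto_of_tendsto' h.norm hz' fun n => ?_
  obtain ⟨k, hk, hre, hkim⟩ := exists_fourth_root (him n)
  -- This rate depends on `n` and may tend to zero; the estimate below is uniform in it.
  have hδ := lt_min hre hkim
  have hbound := norm_resolvent_le hδ (min_le_left _ _) (min_le_right _ _) hφ hM (r := r n)
    (by rw [hk]; exact hr n)
  have hk2 : ‖k ^ 2‖ = √‖z n‖ := by
    rw [← hk, show k ^ 4 = (k ^ 2) ^ 2 by ring, norm_pow (k ^ 2), Real.sqrt_sq (norm_nonneg _)]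
  rw [hk2] at hbound
  have hle : ‖∫ x, conj ((r n : L2) x) * V x * (ψ : L2) x‖ₑ ≤ ENNReal.ofReal (√‖z n‖)⁻¹ *
      (supQuotient V * ∫⁻ x, ‖V x‖ₑ * ‖(ψ : L2) x‖ₑ ^ 2) := by
    refine (enorm_integral_le_lintegral_enorm _).trans ?_
    grw [← lintegral_potential_mul_yukawa_le hVm hC (ψ : L2) hU hδ hφ hM hφψ]
    rw [← lintegral_const_mul' _ _ ENNReal.ofReal_ne_top]
    refine lintegral_mono_ae ?_
    filter_upwards [hbound] with x hx
    have hx' := ENNReal.ofReal_le_ofReal hx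
    rw [ENNReal.ofReal_mul (by positivity), ofReal_norm, ofReal_norm] at hx'
    rw [enorm_mul, enorm_mul, show ‖conj ((r n : L2) x)‖ₑ = ‖(r n : L2) x‖ₑ by
      rw [← ofReal_norm, RCLike.norm_conj, ofReal_norm], mul_assoc]
    grw [hx']
    exact le_of_eq (by ring)
  have := ENNReal.toReal_mono (ENNReal.mul_ne_top ENNReal.ofReal_ne_top hB) hle
  rwa [ENNReal.toReal_mul, ENNReal.toReal_ofReal (by positivity), toReal_enorm] at this

/-! ### Truncation and conclusion -/

/-- Truncation of the density `|V| |ψ|²`. -/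
theorem lintegral_potential_le {V : E3 → ℂ} (hVm : AEStronglyMeasurable V)
    (hC : supQuotient V ≠ ∞) {ev : ℂ} (hev : ev ≠ 0) {ψ : sobolev 2}
    (hψ : ∀ φ : sobolev 2, form V φ ψ = ev * inner ℂ (φ : L2) (ψ : L2))
    (hU : ∫⁻ x, ‖V x‖ₑ * ‖(ψ : L2) x‖ₑ ^ 2 ≠ ∞) :
    ∫⁻ x, ‖V x‖ₑ * ‖(ψ : L2) x‖ₑ ^ 2 ≤ ENNReal.ofReal ((√‖ev‖)⁻¹ *
      (supQuotient V * ∫⁻ x, ‖V x‖ₑ * ‖(ψ : L2) x‖ₑ ^ 2).toReal) := by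
  set B := (√‖ev‖)⁻¹ * (supQuotient V * ∫⁻ x, ‖V x‖ₑ * ‖(ψ : L2) x‖ₑ ^ 2).toReal
  set v := hVm.mk V
  have hvm : StronglyMeasurable v := hVm.stronglyMeasurable_mk
  have hvV : V =ᵐ[volume] v := hVm.ae_eq_mk
  set p : E3 → ℂ := fun x => (ψ : L2) x
  have hpm : StronglyMeasurable p := Lp.stronglyMeasurable _
  -- Bounding both the density and the support puts the truncated density in `L¹ ∩ L^∞`, where the
  -- convolution representation is valid.
  let A : ℕ → Set E3 := fun N => {x | ‖v x‖ * ‖p x‖ ≤ N} ∩ Metric.closedBall 0 N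
  have hA : ∀ N, MeasurableSet (A N) := fun N =>
    (measurableSet_le (hvm.norm.measurable.mul hpm.norm.measurable) measurable_const).inter
      Metric.isClosed_closedBall.measurableSet
  have hmono : Monotone A := fun N N' h x hx =>
    ⟨show ‖v x‖ * ‖p x‖ ≤ N' from le_trans hx.1 (Nat.cast_le.2 h),
      Metric.closedBall_subset_closedBall (Nat.cast_le.2 h) hx.2⟩
  have hunion : ⋃ N, A N = Set.univ := by
    refine Set.eq_univ_of_forall fun x => Set.mem_iUnion.2 ?_
    obtain ⟨N, hN⟩ := exists_nat_ge (max (‖v x‖ * ‖p x‖) ‖x‖)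
    exact ⟨N, (le_max_left _ _).trans hN, by
      rw [mem_closedBall_zero_iff]
      exact (le_max_right _ _).trans hN⟩
  have hbd : ∀ N, ∫⁻ x in A N, ‖V x‖ₑ * ‖p x‖ₑ ^ 2 ≤ ENNReal.ofReal B := by
    intro N
    -- The modulus of `V` makes the pairing with `ψ` equal to the integral of `|V| |ψ|²` over `A N`,
    -- whatever the phase of `V`.
    let φ : E3 → ℂ := (A N).indicator fun x => (‖v x‖ : ℂ) * p x
    have hM : ∀ x, ‖φ x‖ ≤ N := by
      intro x
      by_cases hx : x ∈ A N
      · simp only [φ, Set.indicator_of_mem hx, norm_mul, Complex.norm_real, norm_norm]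
        exact hx.1
      · simp only [φ, Set.indicator_of_notMem hx, norm_zero]
        positivity
    have hφm : AEStronglyMeasurable φ :=
      (((Complex.measurable_ofReal.comp hvm.norm.measurable).mul hpm.measurable).indicator
        (hA N)).aestronglyMeasurable
    have hφ : Integrable φ := by
      refine (integrableOn_iff_integrable_of_support_subset (s := A N)
        Set.support_indicator_subset).1 ?_
      refine Measure.integrableOn_of_bounded (M := N) ?_ hφm (Eventually.of_forall hM)
      exact ((measure_mono Set.inter_subset_right).trans_lt measure_closedBall_lt_top).ne
    have hφψ : ∀ᵐ x, ‖φ x‖ₑ ≤ ‖V x‖ₑ * ‖p x‖ₑ := by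
      filter_upwards [hvV] with x hx
      by_cases hxA : x ∈ A N
      · simp only [φ, Set.indicator_of_mem hxA, enorm_mul, ← hx]
        simp [← ofReal_norm]
      · simp [φ, Set.indicator_of_notMem hxA]
    have hin := norm_inner_le_of_density hVm hC hev hψ hU hφ hM hφψ
    refine le_trans (le_of_eq ?_) (ENNReal.ofReal_le_ofReal hin)
    have hint : inner ℂ ((memLp_two_of_bounded hφ hM).toLp φ) (ψ : L2) =
        ((∫ x, (A N).indicator (fun x => ‖v x‖ * ‖p x‖ ^ 2) x : ℝ) : ℂ) := by
      rw [← integral_conj_mul, ← integral_complex_ofReal]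
      refine integral_congr_ae ?_
      filter_upwards [(memLp_two_of_bounded hφ hM).coeFn_toLp] with x hx
      rw [hx]
      by_cases hxA : x ∈ A N
      · simp only [φ, Set.indicator_of_mem hxA, map_mul, Complex.conj_ofReal, mul_assoc]
        rw [← Complex.normSq_eq_conj_mul_self, Complex.normSq_eq_norm_sq]
        push_cast
        rfl
      · simp [φ, Set.indicator_of_notMem hxA]
    have hnn : ∀ x, 0 ≤ (A N).indicator (fun x => ‖v x‖ * ‖p x‖ ^ 2) x := fun x =>
      Set.indicator_nonneg (fun _ _ => by positivity) _
    have hmeas : AEStronglyMeasurable ((A N).indicator (fun x => ‖v x‖ * ‖p x‖ ^ 2)) :=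
      ((hvm.norm.measurable.mul (hpm.norm.measurable.pow_const 2)).indicator
        (hA N)).aestronglyMeasurable
    rw [hint, Complex.norm_real, Real.norm_eq_abs, abs_of_nonneg (integral_nonneg hnn),
      integral_eq_lintegral_of_nonneg_ae (Eventually.of_forall hnn) hmeas, ENNReal.ofReal_toReal,
      ← lintegral_indicator (hA N)]
    · refine lintegral_congr_ae ?_
      filter_upwards [hvV] with x hx
      by_cases hxA : x ∈ A N
      · simp only [Set.indicator_of_mem hxA]
        rw [ENNReal.ofReal_mul (norm_nonneg _), ENNReal.ofReal_pow (norm_nonneg _), ofReal_norm,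
          ofReal_norm, ← hx]
      · simp [Set.indicator_of_notMem hxA]
    · refine ne_top_of_le_ne_top hU (lintegral_mono_ae ?_)
      filter_upwards [hvV] with x hx
      by_cases hxA : x ∈ A N
      · simp only [Set.indicator_of_mem hxA]
        rw [ENNReal.ofReal_mul (norm_nonneg _), ENNReal.ofReal_pow (norm_nonneg _), ofReal_norm,
          ofReal_norm, ← hx]
      · simp [Set.indicator_of_notMem hxA]
  rw [← setLIntegral_univ, ← hunion, setLIntegral_iUnion_of_directed _ hmono.directed_le]
  exact iSup_le hbd

theorem represents_hamiltonian {V : E3 → ℂ} (hVm : AEStronglyMeasurable V)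
    (hV : RelFormBounded V) (ψ : (hamiltonian V hVm hV).domain) :
    Represents V ψ (hamiltonian V hVm hV ψ) :=
  ψ.2.choose_spec

theorem enorm_eigenvalue_le {V : E3 → ℂ} (hVm : AEStronglyMeasurable V) (hV : RelFormBounded V)
    {ev : ℂ} {ψ : L2} (hne : ψ ≠ 0) (hR : Represents V ψ (ev • ψ)) :
    ‖ev‖ₑ ≤ supQuotient V ^ 2 := by
  obtain ⟨hmem, hψ⟩ := hR
  simp only [inner_smul_right] at hψ
  by_cases hC : supQuotient V = ∞
  · rw [hC]
    simp
  by_cases hev : ev = 0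
  · rw [hev]
    simp
  obtain ⟨a, -, b, hab⟩ := hV
  set U := ∫⁻ x, ‖V x‖ₑ * ‖ψ x‖ₑ ^ 2 with hUdef
  have hU : U ≠ ∞ := by
    have h := (hab ⟨ψ, hmem⟩).1.2.ne
    refine ne_top_of_le_ne_top h (le_of_eq (lintegral_congr fun x => ?_))
    rw [enorm_mul, enorm_pow, enorm_norm, enorm_norm]
  have hle := lintegral_potential_le hVm hC hev hψ hU
  have hU0 : U ≠ 0 := by
    intro h0
    refine hne (eq_zero_of_potential_eq_zero hψ ?_)
    have hm : AEMeasurable (fun x => ‖V x‖ₑ * ‖ψ x‖ₑ ^ 2) :=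
      hVm.enorm.mul ((Lp.aestronglyMeasurable ψ).enorm.pow_const 2)
    rw [hUdef, lintegral_eq_zero_iff' hm] at h0
    filter_upwards [h0] with x hx
    simpa using hx
  have hs : 0 < √‖ev‖ := Real.sqrt_pos.2 (norm_pos_iff.2 hev)
  have hle' := ENNReal.toReal_mono ENNReal.ofReal_ne_top hle
  rw [ENNReal.toReal_ofReal (by positivity), ENNReal.toReal_mul, inv_mul_eq_div,
    le_div_iff₀ hs, mul_comm] at hle'
  -- Cancelling `U`, which is positive and finite, leaves `√|ev| ≤ C`.
  have hfin := le_of_mul_le_mul_right hle' (ENNReal.toReal_pos hU0 hU)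
  have hsq : ‖ev‖ ≤ (supQuotient V).toReal ^ 2 := by
    rw [← Real.sq_sqrt (norm_nonneg ev)]
    gcongr
  rw [← ofReal_norm, ← ENNReal.ofReal_toReal hC, ← ENNReal.ofReal_pow ENNReal.toReal_nonneg]
  exact ENNReal.ofReal_le_ofReal hsq

end Biharmonic

theorem theorem3 (V : Biharmonic.E3 → ℂ) (hVm : AEStronglyMeasurable V volume)
    (hV : Biharmonic.RelFormBounded V) :
    Biharmonic.pointSpectrum (Biharmonic.hamiltonian V hVm hV) ⊆
      {z : ℂ | ‖z‖ₑ ≤ Biharmonic.supQuotient V ^ 2} := by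
  rintro ev ⟨ψ, hne, hT⟩
  have hR := Biharmonic.represents_hamiltonian hVm hV ψ
  rw [hT] at hR
  exact Biharmonic.enorm_eigenvalue_le hVm hV hne hR
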